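/- Let $p\ge 2$ be an integer and let $G=G_p$ be the Vilenkin group: the group of sequences $x=(x_j)_{j\in\mathbb Z}$, $x_j\in\{0,\dots,p-1\}$, with $x_j\neq 0$ for at most finitely many negative $j$, under coordinatewise addition $\oplus$ modulo $p$, with neutral element $\theta$, with the topology for which the subgroups $U_l=\{x: x_j=0 \text{ for } j\le l\}$, $l\in\mathbb Z$, form a basis of neighbourhoods of $\theta$, and with the Haar measure $\mu$ normalized by $\mu(U_0)=1$. Let $(Ax)_j=x_{j+1}$. For $\alpha\in\mathbb Z_+$ let $h_{[\alpha]}\in G$ be the element with $x_j=0$ for $j>0$ and $\sum_j x_jp^{-j}=\alpha$, and for $0\le l\le p-1$ let $\delta_l\in G$ be the element with entry $l$ at index $1$ and all other entries $0$. Put $$\chi(x,\omega)=\exp\Big(\frac{2\pi i}{p}\sum_{j\in\mathbb Z}x_j\omega_{1-j}\Big),\qquad \widehat f(\omega)=\int_G f(x)\overline{\chi(x,\omega)}\,d\mu(x),\qquad W_\alpha(\omega)=\chi(\omega,h_{[\alpha]}).$$ A Walsh polynomial is a finite linear combination of the functions $W_\alpha$. A function $\varphi\in L^2(G)$ is called refinable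 if $\varphi(x)=p\sum_{\alpha=0}^\infty a_\alpha\varphi(Ax\ominus h_{[\alpha]})$ for almost every $x$, for some complex coefficients $a_\alpha$ (the series converging unconditionally at almost every $x$). If $\varphi(x)=p\sum_{\alpha=0}^{p^n-1}a_\alpha\varphi(Ax\ominus h_{[\alpha]})$ almost everywhere for some $n\in\mathbb Z_+$ and some $a_\alpha\in\mathbb C$, then the function $m_0=\sum_{\alpha=0}^{p^n-1}a_\alpha\overline{W_\alpha}$ is called a mask of $\varphi$. We say that a compactly supported refinable function $\varphi$ with mask $m_0$ generates a compactly supported tight wavelet frame if there are $r\ge p-1$ and Walsh polynomials $m_1,\dots,m_r$ such that for every $\omega\in G$ the rows of the matrix $\big(m_\nu(\omega\oplus\delta_l)\big)_{0\le l\le p-1,\ 0\le\nu\le r}$ are orthonormal, and compactly supported functions $\psi^{(1)},\dots,\psi^{(r)}\in L^2(G)$ with $$\widehat{\psi^{(\nu)}}(\omega)=m_\nu(A^{-1}\omega)\,\widehat\varphi(A^{-1}\omega),\qquad \omega\in G,$$ such that the functions $\psi^{(\nu)}_{j,k}(x)=p^{j/2}\psi^{(\nu)}(A^jx\ominus h_{[k]})$,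 $1\le\nu\le r$, $j\in\mathbb Z$, $k\in\mathbb Z_+$, form a tight frame, i.e. for some constant $C>0$ $$\sum_{\nu=1}^r\sum_{j\in\mathbb Z}\sum_{k\in\mathbb Z_+}|\langle f,\psi^{(\nu)}_{j,k}\rangle|^2=C\|f\|_2^2\qquad\text{for all } f\in L^2(G).$$ **Theorem.** Let $\varphi\in L^2(G)$ be a compactly supported refinable function that is not almost everywhere zero. Then $\varphi$ has a mask. Moreover, for every mask $m_0$ of $\varphi$, the function $\varphi$ with mask $m_0$ generates a compactly supported tight wavelet frame if and only if $m_0$ is a Walsh polynomial with $$m_0(\theta)=1\qquad\text{and}\qquad \sum_{l=0}^{p-1}|m_0(\omega\oplus\delta_l)|^2\le 1\quad\text{for all }\omega\in G.$$ -/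

import Mathlib

open MeasureTheory

/-- Two-sided sequences with entries in `ℤ/p` having only finitely many nonzero entries with
negative index, as a subgroup of `ℤ → ZMod p` under coordinatewise addition modulo `p`. -/
def vilenkinSubgroup (p : ℕ) : AddSubgroup (ℤ → ZMod p) where
  carrier := {x | ∃ k : ℤ, ∀ j ≤ k, x j = 0}
  zero_mem' := ⟨0, fun _ _ => rfl⟩
  add_mem' := by
    rintro x y ⟨k, hk⟩ ⟨l, hl⟩
    refine ⟨min k l, fun j hj => ?_⟩
    simp [hk j (hj.trans (min_le_left _ _)), hl j (hj.trans (min_le_right _ _))]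
  neg_mem' := by
    rintro x ⟨k, hk⟩
    exact ⟨k, fun j hj => by simp [hk j hj]⟩

/-- The Vilenkin group `G_p`. (A `def`, so that it does not inherit the product topology.) -/
def Vilenkin (p : ℕ) : Type := vilenkinSubgroup p

namespace Vilenkin

noncomputable section

instance (p : ℕ) : AddCommGroup (Vilenkin p) :=
  inferInstanceAs (AddCommGroup (vilenkinSubgroup p))

/-- The `j`-th entry of a sequence. -/
def coord {p : ℕ} (x : Vilenkin p) (j : ℤ) : ZMod p := x.1 j

@[ext] theorem ext {p : ℕ} {x y : Vilenkin p} (h : ∀ j, x.coord j = y.coord j) : x = y :=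
  Subtype.ext (funext h)

theorem eventually_zero {p : ℕ} (x : Vilenkin p) : ∃ k : ℤ, ∀ j ≤ k, x.coord j = 0 := x.2

@[simp] theorem coord_zero {p : ℕ} (j : ℤ) : (0 : Vilenkin p).coord j = 0 := rfl

@[simp] theorem coord_add {p : ℕ} (x y : Vilenkin p) (j : ℤ) :
    (x + y).coord j = x.coord j + y.coord j := rfl

@[simp] theorem coord_neg {p : ℕ} (x : Vilenkin p) (j : ℤ) : (-x).coord j = -x.coord j := rfl

@[simp] theorem coord_sub {p : ℕ} (x y : Vilenkin p) (j : ℤ) :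
    (x - y).coord j = x.coord j - y.coord j := by simp [sub_eq_add_neg]

/-- The subgroups `U_l = {x | x_j = 0 for all j ≤ l}`. -/
def U (p : ℕ) (l : ℤ) : AddSubgroup (Vilenkin p) where
  carrier := {x | ∀ j ≤ l, x.coord j = 0}
  zero_mem' := fun _ _ => rfl
  add_mem' := fun hx hy j hj => by simp [hx j hj, hy j hj]
  neg_mem' := fun hx j hj => by simp [hx j hj]

theorem mem_U {p : ℕ} {l : ℤ} {x : Vilenkin p} : x ∈ U p l ↔ ∀ j ≤ l, x.coord j = 0 := Iff.rfl

/-- The sets `U_l` as a basis of neighbourhoods of zero. -/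
@[reducible] def basis (p : ℕ) : AddGroupFilterBasis (Vilenkin p) where
  sets := Set.range fun l : ℤ => (U p l : Set (Vilenkin p))
  nonempty := ⟨_, 0, rfl⟩
  inter_sets := by
    rintro _ _ ⟨k, rfl⟩ ⟨l, rfl⟩
    exact ⟨_, ⟨max k l, rfl⟩, fun x hx =>
      ⟨fun j hj => hx j (hj.trans (le_max_left _ _)), fun j hj => hx j (hj.trans (le_max_right _ _))⟩⟩
  zero' := by
    rintro _ ⟨l, rfl⟩
    exact (U p l).zero_mem
  add' := by
    rintro _ ⟨l, rfl⟩
    refine ⟨_, ⟨l, rfl⟩, ?_⟩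
    rintro _ ⟨x, hx, y, hy, rfl⟩
    exact (U p l).add_mem hx hy
  neg' := by
    rintro _ ⟨l, rfl⟩
    exact ⟨_, ⟨l, rfl⟩, fun x hx => (U p l).neg_mem hx⟩
  conj' := by
    rintro x _ ⟨l, rfl⟩
    exact ⟨_, ⟨l, rfl⟩, fun y hy => by simpa using hy⟩

instance (p : ℕ) : TopologicalSpace (Vilenkin p) := (basis p).topology

instance (p : ℕ) : IsTopologicalAddGroup (Vilenkin p) := (basis p).isTopologicalAddGroup

instance (p : ℕ) : MeasurableSpace (Vilenkin p) := borel _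

instance (p : ℕ) : BorelSpace (Vilenkin p) := ⟨rfl⟩

theorem U_mem_nhds (p : ℕ) (l : ℤ) : (U p l : Set (Vilenkin p)) ∈ nhds (0 : Vilenkin p) :=
  (basis p).mem_nhds_zero ⟨l, rfl⟩

/-- A sequence restricted to positive indices. -/
def truncate (p : ℕ) (y : ℤ → ZMod p) : Vilenkin p :=
  ⟨fun j => if j ≤ 0 then 0 else y j, 0, fun _ hj => if_pos hj⟩

@[simp] theorem coord_truncate (p : ℕ) (y : ℤ → ZMod p) (j : ℤ) :
    (truncate p y).coord j = if j ≤ 0 then 0 else y j := rfl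

theorem isCompact_U_zero (p : ℕ) [NeZero p] : IsCompact (U p 0 : Set (Vilenkin p)) := by
  let _ : TopologicalSpace (ZMod p) := ⊥
  have _ : DiscreteTopology (ZMod p) := ⟨rfl⟩
  have hc : Continuous (truncate p) := by
    refine continuous_iff_continuousAt.2 fun y => ?_
    rw [ContinuousAt, ((basis p).nhds_hasBasis _).tendsto_right_iff]
    rintro _ ⟨l, rfl⟩
    have hfin : (Set.Icc (1 : ℤ) l).Finite := Set.finite_Icc _ _
    have hev : ∀ᶠ z in nhds y, ∀ j ∈ Set.Icc (1 : ℤ) l, z j = y j := by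
      rw [hfin.eventually_all]
      intro j _
      exact (continuous_apply j).continuousAt.eventually
        (show ({y j} : Set (ZMod p)) ∈ nhds (y j) from (isOpen_discrete _).mem_nhds rfl)
    filter_upwards [hev] with z hz
    refine ⟨truncate p z - truncate p y, fun j hj => ?_, by simp⟩
    by_cases h0 : j ≤ 0
    · simp [h0]
    · simp [h0, hz j ⟨by omega, hj⟩]
  have hr : (U p 0 : Set (Vilenkin p)) = Set.range (truncate p) := by
    ext x
    constructor
    · intro hx
      refine ⟨x.1, ext fun j => ?_⟩
      by_cases h0 : j ≤ 0
      · simp [h0, hx j h0]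
      · rw [coord_truncate, if_neg h0]
        rfl
    · rintro ⟨y, rfl⟩ j hj
      simp [hj]
  rw [hr]
  exact isCompact_range hc

/-- The Haar measure `μ` of the Vilenkin group, normalized by `μ(U_0) = 1`. -/
def haar (p : ℕ) [NeZero p] : Measure (Vilenkin p) :=
  Measure.addHaarMeasure
    ⟨⟨(U p 0 : Set (Vilenkin p)), isCompact_U_zero p⟩,
      ⟨0, mem_interior_iff_mem_nhds.2 (U_mem_nhds p 0)⟩⟩

/-- The integer powers `A^n` of the automorphism `(A x)_j = x_{j+1}`. -/
def dil {p : ℕ} (n : ℤ) (x : Vilenkin p) : Vilenkin p :=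
  ⟨fun j => x.coord (j + n), by
    obtain ⟨k, hk⟩ := x.eventually_zero
    exact ⟨k - n, fun j hj => hk _ (by omega)⟩⟩

/-- The element `h_[α]` of `H = {x | x_j = 0 for j > 0}` with `∑ x_j p^(-j) = α`: its entry with
index `-i` is the `i`-th base `p` digit of `α`. -/
def h (p : ℕ) [NeZero p] (α : ℕ) : Vilenkin p :=
  ⟨fun j => if j ≤ 0 then ((α / p ^ (-j).toNat : ℕ) : ZMod p) else 0, by
    refine ⟨-(α : ℤ), fun j hj => ?_⟩
    have hj0 : j ≤ 0 := by omega
    simp only [hj0, if_true]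
    rcases Nat.lt_or_ge 1 p with hp | hp
    · have h1 : α < p ^ (-j).toNat :=
        lt_of_le_of_lt (show α ≤ (-j).toNat by omega) (Nat.lt_pow_self hp)
      simp [Nat.div_eq_of_lt h1]
    · obtain rfl : p = 1 := le_antisymm hp (Nat.one_le_iff_ne_zero.2 (NeZero.ne p))
      exact Subsingleton.elim _ _⟩

/-- The element `δ_l`, `0 ≤ l < p`, with `∑ x_j p^(-j) = l / p`: the entry with index `1` is `l`,
all others are zero. -/
def delta (p : ℕ) (l : ℕ) : Vilenkin p :=
  ⟨fun j => if j = 1 then (l : ZMod p) else 0, 0, fun j hj => if_neg (by omega)⟩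

/-- The characters `χ(x, ω) = exp (2πi/p * ∑_j x_j ω_{1-j})`; the sum has finitely many nonzero
terms, and entries are represented by integers in `{0, …, p-1}`. -/
def chi {p : ℕ} (x ω : Vilenkin p) : ℂ :=
  Complex.exp (2 * Real.pi * Complex.I / p *
    ((∑ᶠ j : ℤ, (x.coord j).val * (ω.coord (1 - j)).val : ℕ) : ℂ))

/-- The Fourier transform (of integrable functions). -/
def fourier {p : ℕ} [NeZero p] (f : Vilenkin p → ℂ) (ω : Vilenkin p) : ℂ :=
  ∫ x, f x * starRingEnd ℂ (chi x ω) ∂haar p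

/-- The generalized Walsh functions `W_α`. -/
def walsh (p : ℕ) [NeZero p] (α : ℕ) (x : Vilenkin p) : ℂ := chi x (h p α)

/-- Walsh polynomials: finite linear combinations of generalized Walsh functions. -/
def IsWalshPolynomial {p : ℕ} [NeZero p] (m : Vilenkin p → ℂ) : Prop :=
  m ∈ Submodule.span ℂ (Set.range (walsh p))

/-- `φ ∈ L²` satisfies a refinement equation `φ(x) = p ∑_{α ≥ 0} a_α φ(A x ⊖ h_[α])`. -/
def IsRefinable {p : ℕ} [NeZero p] (φ : Vilenkin p → ℂ) : Prop :=
  MemLp φ 2 (haar p) ∧ ∃ a : ℕ → ℂ,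
    ∀ᵐ x ∂haar p, HasSum (fun α : ℕ => (p : ℂ) * (a α * φ (dil 1 x - h p α))) (φ x)

/-- `m₀` is a mask of `φ`: for some `n` and coefficients `a_0, …, a_{p^n - 1}` one has
`φ(x) = p ∑_{α < p^n} a_α φ(A x ⊖ h_[α])` in `L²` and `m₀ = ∑_{α < p^n} a_α conj W_α`. -/
def IsMask {p : ℕ} [NeZero p] (φ m₀ : Vilenkin p → ℂ) : Prop :=
  ∃ (n : ℕ) (a : ℕ → ℂ),
    (∀ᵐ x ∂haar p, φ x = p * ∑ α ∈ Finset.range (p ^ n), a α * φ (dil 1 x - h p α)) ∧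
    ∀ ω, m₀ ω = ∑ α ∈ Finset.range (p ^ n), a α * starRingEnd ℂ (walsh p α ω)

/-- The matrix `M(ω)` with rows `(m_0(ω ⊕ δ_l), …, m_r(ω ⊕ δ_l))`, `l = 0, …, p-1`. -/
def maskMatrix {p r : ℕ} (m : Fin (r + 1) → Vilenkin p → ℂ) (ω : Vilenkin p) :
    Matrix (Fin p) (Fin (r + 1)) ℂ :=
  Matrix.of fun l ν => m ν (ω + delta p l)

/-- The functions `ψ_{j,k}(x) = p^(j/2) ψ(A^j x ⊖ h_[k])`. -/
def wavelet {p : ℕ} [NeZero p] (ψ : Vilenkin p → ℂ) (j : ℤ) (k : ℕ) (x : Vilenkin p) : ℂ :=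
  (((p : ℝ) ^ ((j : ℝ) / 2) : ℝ) : ℂ) * ψ (dil j x - h p k)

/-- A family of functions in `L²(G)` is a tight frame: for some `C > 0`,
`∑_i |⟨f, g_i⟩|² = C ‖f‖²` for all `f ∈ L²(G)`. -/
def IsTightFrame {p : ℕ} [NeZero p] {ι : Type*} (g : ι → Vilenkin p → ℂ) : Prop :=
  (∀ i, MemLp (g i) 2 (haar p)) ∧ ∃ C : ℝ, 0 < C ∧
    ∀ f : Vilenkin p → ℂ, MemLp f 2 (haar p) →
      HasSum (fun i => ‖∫ x, f x * starRingEnd ℂ (g i x) ∂haar p‖ ^ 2)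
        (C * ∫ x, ‖f x‖ ^ 2 ∂haar p)

/-- The refinable function `φ` with mask `m₀` generates a compactly supported tight wavelet frame:
there are `r ≥ p - 1` wavelet masks `m_1, …, m_r` (Walsh polynomials with `M(ω) M(ω)* = I`) such
that the wavelet functions given by `ψ̂^(ν)(ω) = m_ν(A⁻¹ω) φ̂(A⁻¹ω)` are compactly supported and the
wavelet system is a tight frame. (Compactly supported functions in `L²` are integrable, so their
Fourier transforms are given by the integral.) -/
def GeneratesTightFrame {p : ℕ} [NeZero p] (φ m₀ : Vilenkin p → ℂ) : Prop :=
  ∃ (r : ℕ) (m ψ : Fin r → Vilenkin p → ℂ),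
    p - 1 ≤ r ∧
    (∀ ν, IsWalshPolynomial (m ν)) ∧
    (∀ ω, maskMatrix (Fin.cons m₀ m : Fin (r + 1) → Vilenkin p → ℂ) ω *
      (maskMatrix (Fin.cons m₀ m : Fin (r + 1) → Vilenkin p → ℂ) ω).conjTranspose = 1) ∧
    (∀ ν, MemLp (ψ ν) 2 (haar p) ∧ HasCompactSupport (ψ ν) ∧
      ∀ ω, fourier (ψ ν) ω = m ν (dil (-1) ω) * fourier φ (dil (-1) ω)) ∧
    IsTightFrame fun i : Fin r × ℤ × ℕ => wavelet (ψ i.1) i.2.1 i.2.2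

end

end Vilenkin

namespace Vilenkin

open Filter Topology
open scoped ENNReal Pointwise ComplexConjugate

noncomputable section

variable {p : ℕ}

/-! ### Dilations -/

/-! A mask exists because supports are nested: if `φ` vanishes off `U_{-N}`, then for `x` in
`U_{-N}` only translates by `h_[α]` in `U_{-(N+1)}` contribute, so the refinement series is finite
(`exists_isMask`).

A mask is a Walsh polynomial by its form. Integrating the refinement equation gives `m₀(θ) ∫φ = ∫φ`,
so `m₀(θ) = 1` once `∫φ ≠ 0`. If `∫φ` were zero, a locally constant `f` would be orthogonal to all
translates of `φ` at a fine scale, where `f` is constant on their supports; the refinement equation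
passes orthogonality to coarser scales, hence to `φ` itself, and `φ = 0` by density
(`integral_ne_zero_of_refinable`). The inequality is necessary because a matrix with orthonormal
rows has columns of norm at most one (`sum_norm_sq_col_le_one`).

Conversely, let `v` be the column of values `m₀(ω ⊕ δ_l)`. The matrix `(v | I - c v v*)` with `c = 1
/ (1 + √(1 - |v|²))` has orthonormal rows. Its entries are not polynomial in `m₀`, but they depend
on finitely many entries of `ω`, and this already makes them Walsh polynomials
(`exists_wavelet_masks`, `IsCylinder.isWalshPolynomial`).

The frame identity is then proved on the time side. Put `S(j) = ∑_κ |⟨f, φ_{j,κ}⟩|²`. Orthonormality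
of the masks says that the filter bank preserves the `ℓ²` norm (`exists_hasSum_analysisFilter`), so
`S(j+1) - S(j)` is the wavelet energy at scale `j`. For a step function `f`, `S(j)` equals `|∫φ|²
‖f‖²` for large `j` and tends to `0` as `j → -∞`. Telescoping gives the identity with `C = |∫φ|²`,
and density extends it to `L²` (`isTightFrame_synth`). -/

@[simp] theorem coord_dil (n : ℤ) (x : Vilenkin p) (j : ℤ) :
    (dil n x).coord j = x.coord (j + n) := rfl

theorem dil_dil (m n : ℤ) (x : Vilenkin p) : dil m (dil n x) = dil (m + n) x := by
  ext j; simp [add_assoc]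

@[simp] theorem dil_zero (x : Vilenkin p) : dil 0 x = x := by
  ext j; simp

theorem dil_add (n : ℤ) (x y : Vilenkin p) : dil n (x + y) = dil n x + dil n y := by
  ext j; simp

theorem dil_sub (n : ℤ) (x y : Vilenkin p) : dil n (x - y) = dil n x - dil n y := by
  ext j; simp

theorem dil_mem_U {n l : ℤ} {x : Vilenkin p} : dil n x ∈ U p l ↔ x ∈ U p (l + n) := by
  simp only [mem_U, coord_dil]
  constructor
  · intro hx j hj
    simpa using hx (j - n) (by omega)
  · intro hx j hj
    exact hx _ (by omega)

/-- The dilation `A^n` as an additive automorphism. -/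
@[simps] def dilEquiv (p : ℕ) (n : ℤ) : Vilenkin p ≃+ Vilenkin p where
  toFun := dil n
  invFun := dil (-n)
  left_inv x := by simp [dil_dil]
  right_inv x := by simp [dil_dil]
  map_add' := dil_add n

theorem U_anti {k l : ℤ} (hkl : k ≤ l) : U p l ≤ U p k :=
  fun _ hx j hj => hx j (hj.trans hkl)

theorem exists_mem_U (x : Vilenkin p) : ∃ l, x ∈ U p l := x.eventually_zero

/-! ### The discrete subgroup `H` -/

/-- The subgroup `H` of sequences without entries at positive indices. -/
def H (p : ℕ) : AddSubgroup (Vilenkin p) where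
  carrier := {x | ∀ j, 0 < j → x.coord j = 0}
  zero_mem' := fun _ _ => rfl
  add_mem' := fun hx hy j hj => by simp [hx j hj, hy j hj]
  neg_mem' := fun hx j hj => by simp [hx j hj]

theorem eq_zero_of_mem_H_of_mem_U {x : Vilenkin p} (hx : x ∈ H p) (hx' : x ∈ U p 0) : x = 0 := by
  ext j
  rcases le_or_gt j 0 with hj | hj
  · simpa using hx' j hj
  · simpa using hx j hj

/-- The part of a sequence with nonpositive indices. -/
def intPart (x : Vilenkin p) : H p :=
  ⟨⟨fun j => if j ≤ 0 then x.coord j else 0, by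
    obtain ⟨k, hk⟩ := x.eventually_zero
    exact ⟨k, fun j hj => by simp [hk j hj]⟩⟩, fun j hj => if_neg (by omega)⟩

theorem coord_intPart (x : Vilenkin p) (j : ℤ) :
    (intPart x : Vilenkin p).coord j = if j ≤ 0 then x.coord j else 0 := rfl

theorem sub_intPart_mem (x : Vilenkin p) : x - intPart x ∈ U p 0 := by
  intro j hj
  simp [coord_intPart, hj]

theorem intPart_unique {x : Vilenkin p} {κ : H p} (hx : x - κ ∈ U p 0) : intPart x = κ := by
  apply Subtype.ext
  rw [← sub_eq_zero]
  refine eq_zero_of_mem_H_of_mem_U ((H p).sub_mem (intPart x).2 κ.2) ?_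
  have := (U p 0).sub_mem hx (sub_intPart_mem x)
  simpa using this

theorem intPart_eq_iff {x : Vilenkin p} {κ : H p} : intPart x = κ ↔ x - κ ∈ U p 0 :=
  ⟨fun hx => hx ▸ sub_intPart_mem x, intPart_unique⟩

/-- The dilation `A` as a map of `H` to itself. -/
def dilH (κ : H p) : H p := ⟨dil 1 κ, fun j hj => κ.2 _ (by omega)⟩

@[simp] theorem coe_dilH (κ : H p) : (dilH κ : Vilenkin p) = dil 1 (κ : Vilenkin p) := rfl

theorem dilH_injective : Function.Injective (dilH : H p → H p) := fun x y hxy => by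
  apply Subtype.ext
  exact (dilEquiv p 1).injective (congrArg Subtype.val hxy)

/-- The entry with index 0 is the one that pairs with `δ_l`, so this identifies the frequencies that
survive averaging over the `δ_l`. -/
theorem mem_range_dilH {κ : H p} : κ ∈ Set.range (dilH : H p → H p) ↔
    (κ : Vilenkin p).coord 0 = 0 := by
  constructor
  · rintro ⟨y, rfl⟩
    simpa using y.2 1 one_pos
  · intro h0
    refine ⟨⟨dil (-1) κ, fun j hj => ?_⟩, Subtype.ext (by simp [dil_dil])⟩
    rcases eq_or_lt_of_le (Int.add_one_le_iff.2 hj) with hj1 | hj1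
    · rw [coord_dil, ← hj1]; simpa using h0
    · exact κ.2 _ (by omega)

variable [NeZero p]

theorem coord_h (α : ℕ) (j : ℤ) :
    (h p α).coord j = if j ≤ 0 then ((α / p ^ (-j).toNat : ℕ) : ZMod p) else 0 := rfl

theorem h_mem_H (α : ℕ) : h p α ∈ H p := fun j hj => by
  rw [coord_h, if_neg (by omega)]

theorem h_mem_U {α n : ℕ} (hα : α < p ^ n) : h p α ∈ U p (-n) := by
  intro j hj
  have h1 : α < p ^ (-j).toNat :=
    lt_of_lt_of_le hα (Nat.pow_le_pow_right (NeZero.pos p) (by omega))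
  simp [coord_h, Nat.div_eq_of_lt h1]

theorem h_zero : h p 0 = 0 := by
  ext j; simp [coord_h]

theorem h_coord_zero (α : ℕ) : (h p α).coord 0 = (α : ZMod p) := by
  simp [coord_h]

/-- Dropping the last base `p` digit is a shift of the sequence; this drives the inductions on
digits below. -/
theorem h_coord_sub_one (α : ℕ) {j : ℤ} (hj : j ≤ 0) :
    (h p α).coord (j - 1) = (h p (α / p)).coord j := by
  have h1 : (-(j - 1)).toNat = (-j).toNat + 1 := by omega
  simp only [coord_h, hj, if_true, show j - 1 ≤ 0 by omega, h1, pow_succ', Nat.div_div_eq_div_mul]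

theorem h_injective (hp : 2 ≤ p) : Function.Injective (h p) := by
  intro α
  induction α using Nat.strong_induction_on with
  | _ α ih =>
    intro β hβ
    have h0 : α % p = β % p := by
      rw [← ZMod.natCast_eq_natCast_iff', ← h_coord_zero, ← h_coord_zero, hβ]
    have h1 : h p (α / p) = h p (β / p) := by
      ext j
      rcases le_or_gt j 0 with hj | hj
      · rw [← h_coord_sub_one _ hj, ← h_coord_sub_one _ hj, hβ]
      · rw [h_mem_H _ j hj, h_mem_H _ j hj]
    rcases Nat.eq_zero_or_pos α with rfl | hα
    · by_contra hne
      have hβ0 : 0 < β := Nat.pos_of_ne_zero (Ne.symm hne)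
      -- Division by `p` does not decrease `α = 0`, so this case needs its own induction, on the
      -- other argument.
      have : ∀ b, 0 < b → h p b ≠ 0 := by
        intro b
        induction b using Nat.strong_induction_on with
        | _ b ihb =>
          intro hb hb0
          have e0 : (b : ZMod p) = 0 := by rw [← h_coord_zero, hb0]; simp
          have e1 : h p (b / p) = 0 := by
            ext j
            rcases le_or_gt j 0 with hj | hj
            · rw [← h_coord_sub_one _ hj, hb0]; simp
            · rw [h_mem_H _ j hj]; simp
          have e2 := (ZMod.natCast_eq_zero_iff b p).1 e0
          exact ihb _ (Nat.div_lt_self hb hp) (Nat.div_pos (Nat.le_of_dvd hb e2) (by omega)) e1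
      exact this β hβ0 (by rw [← hβ, h_zero])
    · have h2 := ih (α / p) (Nat.div_lt_self hα hp) h1
      rw [← Nat.div_add_mod α p, ← Nat.div_add_mod β p, h2, h0]

theorem exists_h_eq {n : ℕ} {x : Vilenkin p} (hx : x ∈ H p) (hn : x ∈ U p (-n)) :
    ∃ α < p ^ n, h p α = x := by
  induction n generalizing x with
  | zero => exact ⟨0, by simp, by rw [h_zero, eq_zero_of_mem_H_of_mem_U hx (by simpa using hn)]⟩
  | succ n ih =>
    -- `A⁻¹` moves the last digit `x_0` to index 1, where the integral part discards it; `β` encodes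
    -- the remaining digits.
    obtain ⟨β, hβ, e⟩ := ih (x := intPart (dil (-1) x)) (intPart _).2 (fun j hj => by
      rw [coord_intPart, if_pos (by omega), coord_dil]
      exact hn _ (by push_cast; omega))
    have hpos : 0 < p := NeZero.pos p
    have hv := ZMod.val_lt (x.coord 0)
    refine ⟨p * β + (x.coord 0).val, ?_, ?_⟩
    · calc p * β + (x.coord 0).val < p * β + p := by omega
        _ = p * (β + 1) := by ring
        _ ≤ p * p ^ n := Nat.mul_le_mul_left _ hβ
        _ = p ^ (n + 1) := by ring
    · ext j
      rcases lt_trichotomy j 0 with hj | rfl | hj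
      · have := h_coord_sub_one (p := p) (p * β + (x.coord 0).val) (j := j + 1) (by omega)
        rw [add_sub_cancel_right] at this
        rw [this, Nat.mul_add_div hpos, Nat.div_eq_of_lt hv, add_zero, e, coord_intPart,
          if_pos (by omega)]
        simp
      · rw [h_coord_zero]; simp
      · rw [h_mem_H _ j hj, hx j hj]

theorem lt_pow_of_h_mem_U (hp : 2 ≤ p) {α n : ℕ} (hα : h p α ∈ U p (-n)) : α < p ^ n := by
  obtain ⟨β, hβ, e⟩ := exists_h_eq (h_mem_H α) hα
  rwa [← h_injective hp e]

/-- The enumeration of `H` by natural numbers. -/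
def hEquiv (hp : 2 ≤ p) : ℕ ≃ H p :=
  Equiv.ofBijective (fun α => ⟨h p α, h_mem_H α⟩)
    ⟨fun _ _ e => h_injective hp (congrArg Subtype.val e), fun x => by
      obtain ⟨l, hl⟩ := exists_mem_U (x : Vilenkin p)
      obtain ⟨α, -, e⟩ := exists_h_eq (n := (-l).toNat) x.2 (U_anti (by omega) hl)
      exact ⟨α, Subtype.ext e⟩⟩

instance : Countable (H p) := by
  refine Function.Surjective.countable (f := fun α : ℕ => (⟨h p α, h_mem_H α⟩ : H p)) fun x => ?_
  obtain ⟨l, hl⟩ := exists_mem_U (x : Vilenkin p)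
  obtain ⟨α, -, e⟩ := exists_h_eq (n := (-l).toNat) x.2 (U_anti (by omega) hl)
  exact ⟨α, Subtype.ext e⟩

/-- Discreteness of `H`: it makes every coefficient family of a compactly supported `f` finitely
supported. -/
theorem finite_H_inter_U (l : ℤ) : {κ : H p | (κ : Vilenkin p) ∈ U p l}.Finite := by
  refine ((Finset.range (p ^ (-l).toNat)).finite_toSet.image
    fun α => (⟨h p α, h_mem_H α⟩ : H p)).subset ?_
  intro x hx
  obtain ⟨α, hα, e⟩ := exists_h_eq (n := (-l).toNat) x.2 (U_anti (by omega) hx)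
  exact ⟨α, by simpa using hα, Subtype.ext e⟩

/-! ### Topology -/

omit [NeZero p] in
theorem nhds_hasBasis (x : Vilenkin p) :
    (𝓝 x).HasBasis (fun _ : ℤ => True) fun l => {y | y - x ∈ U p l} := by
  have := (basis p).nhds_hasBasis x
  refine ⟨fun t => ?_⟩
  rw [this.mem_iff]
  constructor
  · rintro ⟨_, ⟨l, rfl⟩, hl⟩
    exact ⟨l, trivial, fun y hy => hl ⟨y - x, hy, by simp⟩⟩
  · rintro ⟨l, -, hl⟩
    refine ⟨_, ⟨l, rfl⟩, ?_⟩
    rintro _ ⟨y, hy, rfl⟩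
    exact hl (by simpa using hy)

omit [NeZero p] in
theorem isOpen_U (l : ℤ) : IsOpen (U p l : Set (Vilenkin p)) :=
  (U p l).isOpen_of_mem_nhds (g := 0) (by simpa using U_mem_nhds p l)

omit [NeZero p] in
theorem isOpen_coset (l : ℤ) (x : Vilenkin p) : IsOpen {y | y - x ∈ U p l} :=
  (isOpen_U l).preimage (continuous_sub_right x)

omit [NeZero p] in
theorem isClosed_U (l : ℤ) : IsClosed (U p l : Set (Vilenkin p)) :=
  (U p l).isClosed_of_isOpen (isOpen_U l)

omit [NeZero p] in
theorem continuous_dil (n : ℤ) : Continuous (dil n : Vilenkin p → Vilenkin p) := by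
  refine continuous_iff_continuousAt.2 fun x => ?_
  rw [ContinuousAt, ((nhds_hasBasis x).tendsto_iff (nhds_hasBasis _))]
  exact fun l _ => ⟨l + n, trivial, fun y hy => by
    simpa only [Set.mem_ofPred_eq, ← dil_sub, dil_mem_U] using hy⟩

/-- The dilation `A^n` as a homeomorphism. -/
def dilHomeo (p : ℕ) (n : ℤ) : Vilenkin p ≃ₜ Vilenkin p where
  toEquiv := (dilEquiv p n).toEquiv
  continuous_toFun := continuous_dil n
  continuous_invFun := continuous_dil (-n)

theorem isCompact_U (l : ℤ) : IsCompact (U p l : Set (Vilenkin p)) := by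
  have := (isCompact_U_zero p).image (continuous_dil (-l))
  refine this.of_isClosed_subset (isClosed_U l) fun x hx => ⟨dil l x, ?_, by simp [dil_dil]⟩
  exact dil_mem_U.2 (by simpa using hx)

instance : LocallyCompactSpace (Vilenkin p) :=
  (isCompact_U_zero p).locallyCompactSpace_of_mem_nhds_of_addGroup (U_mem_nhds p 0)

omit [NeZero p] in
instance : T2Space (Vilenkin p) := by
  have : T1Space (Vilenkin p) := by
    refine IsTopologicalAddGroup.t1Space _ ?_
    have : ({0} : Set (Vilenkin p)) = ⋂ l : ℤ, (U p l : Set (Vilenkin p)) := by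
      ext x
      simp only [Set.mem_singleton_iff, Set.mem_iInter, SetLike.mem_coe]
      constructor
      · rintro rfl l; exact (U p l).zero_mem
      · intro hx; ext j; exact hx j j le_rfl
    rw [this]
    exact isClosed_iInter fun l => isClosed_U l
  infer_instance

omit [NeZero p] in
/-- Every point lies in the coset of `U_l` of a point of the countable set `A^(-l) H`. -/
theorem sub_dil_intPart_mem (l : ℤ) (x : Vilenkin p) :
    x - dil (-l) (intPart (dil l x) : Vilenkin p) ∈ U p l := by
  have := sub_intPart_mem (dil l x)
  have h2 : dil (-l) (dil l x - (intPart (dil l x) : Vilenkin p)) ∈ U p l := dil_mem_U.2 (by simpa using this)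
  simpa [dil_sub, dil_dil] using h2

instance : SecondCountableTopology (Vilenkin p) := by
  have hb : TopologicalSpace.IsTopologicalBasis (Set.range fun q : ℤ × H p =>
      {y : Vilenkin p | y - dil (-q.1) (q.2 : Vilenkin p) ∈ U p q.1}) := by
    refine TopologicalSpace.isTopologicalBasis_of_isOpen_of_nhds ?_ ?_
    · rintro _ ⟨q, rfl⟩; exact isOpen_coset _ _
    · intro x u hx hu
      obtain ⟨l, -, hl⟩ := (nhds_hasBasis x).mem_iff.1 (hu.mem_nhds hx)
      refine ⟨_, ⟨(l, intPart (dil l x)), rfl⟩, sub_dil_intPart_mem l x, fun y hy => hl ?_⟩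
      have := (U p l).sub_mem hy (sub_dil_intPart_mem l x)
      simpa using this
  exact hb.secondCountableTopology (Set.countable_range _)

omit [NeZero p] in
theorem exists_subset_U {K : Set (Vilenkin p)} (hK : IsCompact K) :
    ∃ N : ℕ, K ⊆ (U p (-N) : Set (Vilenkin p)) := by
  obtain ⟨N, hN⟩ := hK.elim_directed_cover (fun N : ℕ => (U p (-N) : Set (Vilenkin p)))
    (fun N => isOpen_U _) (fun x _ => by
      obtain ⟨l, hl⟩ := exists_mem_U x
      exact Set.mem_iUnion.2 ⟨(-l).toNat, U_anti (by omega) hl⟩)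
    (fun a b => ⟨max a b, U_anti (by push_cast; omega), U_anti (by push_cast; omega)⟩)
  exact ⟨N, hN⟩

omit [NeZero p] in
theorem exists_support_subset {f : Vilenkin p → ℂ} (hf : HasCompactSupport f) :
    ∃ N : ℕ, ∀ x ∉ U p (-N), f x = 0 := by
  obtain ⟨N, hN⟩ := exists_subset_U hf
  exact ⟨N, fun x hx => image_eq_zero_of_notMem_tsupport fun h => hx (hN h)⟩

/-! ### Haar measure -/

instance : (haar p).IsAddHaarMeasure := by unfold haar; infer_instance

instance : (haar p).Regular := by unfold haar; infer_instance

theorem haar_U_zero : haar p (U p 0) = 1 := Measure.addHaarMeasure_self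

omit [NeZero p] in
theorem measurable_dil (n : ℤ) : Measurable (dil n : Vilenkin p → Vilenkin p) :=
  (continuous_dil n).measurable

/-- The image measure is again a Haar measure; its constant is its value on `U_0`, whose preimage
under `A^n` is `U_n`. -/
theorem map_dil_haar' (n : ℤ) : (haar p).map (dil n) = haar p (U p n) • haar p := by
  have hinv : ((haar p).map (dil n)).IsAddHaarMeasure :=
    Measure.isAddHaarMeasure_map (haar p) (dilEquiv p n).toAddMonoidHom (continuous_dil n)
      (dilEquiv p n).surjective (dilHomeo p n).isClosedEmbedding.tendsto_cocompact
  have h1 := Measure.addHaarMeasure_unique ((haar p).map (dil n))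
    ⟨⟨(U p 0 : Set (Vilenkin p)), isCompact_U_zero p⟩,
      ⟨0, mem_interior_iff_mem_nhds.2 (U_mem_nhds p 0)⟩⟩
  rw [h1]
  congr 1
  change ((haar p).map (dil n)) (U p 0) = _
  rw [Measure.map_apply (measurable_dil n) (isOpen_U 0).measurableSet]
  congr 1
  ext x
  simpa using dil_mem_U (n := n) (l := 0) (x := x)

/-- The sequence whose only entry is `s` at the index `l`. -/
def single (l : ℤ) (s : ZMod p) : Vilenkin p :=
  ⟨fun j => if j = l then s else 0, l - 1, fun _ hj => if_neg (by omega)⟩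

omit [NeZero p] in
theorem coord_single (l : ℤ) (s : ZMod p) (j : ℤ) :
    (single l s).coord j = if j = l then s else 0 := rfl

theorem haar_coset (l : ℤ) (x : Vilenkin p) : haar p {y | y - x ∈ U p l} = haar p (U p l) := by
  have := measure_preimage_add_right (haar p) (-x) (U p l : Set (Vilenkin p))
  simpa [Set.preimage, ← sub_eq_add_neg] using this

/-- The entry with index `l + 1` splits `U_l` into `p` cosets of `U_{l+1}`. -/
theorem haar_U_succ (l : ℤ) : haar p (U p l) = p * haar p (U p (l + 1)) := by
  have hU : (U p l : Set (Vilenkin p)) =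
      ⋃ s : ZMod p, {y | y - single (l + 1) s ∈ U p (l + 1)} := by
    ext x
    simp only [SetLike.mem_coe, Set.mem_iUnion, Set.mem_ofPred_eq, mem_U, coord_sub, coord_single]
    constructor
    · intro hx
      refine ⟨x.coord (l + 1), fun j hj => ?_⟩
      rcases eq_or_lt_of_le hj with rfl | hj
      · simp
      · simp [hj.ne, hx j (by omega)]
    · rintro ⟨s, hs⟩ j hj
      have := hs j (by omega)
      rwa [if_neg (by omega), sub_zero] at this
  rw [hU, measure_iUnion]
  · simp [haar_coset, tsum_fintype, ZMod.card]
  · intro s t hst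
    refine Set.disjoint_left.2 fun x hs ht => hst ?_
    have h1 := hs (l + 1) le_rfl
    have h2 := ht (l + 1) le_rfl
    simp only [coord_sub, coord_single, if_true, sub_eq_zero] at h1 h2
    rw [← h1, ← h2]
  · exact fun s => (isOpen_coset _ _).measurableSet

theorem haar_U (l : ℤ) : haar p (U p l) = (p : ℝ≥0∞) ^ (-l) := by
  have h0 : (p : ℝ≥0∞) ≠ 0 := by exact_mod_cast NeZero.ne p
  have ht : (p : ℝ≥0∞) ≠ ⊤ := ENNReal.natCast_ne_top p
  induction l using Int.induction_on with
  | zero => simp [haar_U_zero]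
  | succ i ih =>
    have h1 := haar_U_succ (p := p) i
    rw [ih, show (-(i : ℤ)) = 1 + (-(i + 1 : ℤ)) by ring, ENNReal.zpow_add h0 ht, zpow_one] at h1
    exact ((ENNReal.mul_right_inj h0 ht).1 h1).symm
  | pred i ih =>
    have h1 := haar_U_succ (p := p) (-i - 1)
    rw [sub_add_cancel, ih] at h1
    rw [h1, show -(-(i : ℤ) - 1) = 1 + - -(i : ℤ) by ring, ENNReal.zpow_add h0 ht, zpow_one]

theorem map_dil_haar (n : ℤ) : (haar p).map (dil n) = ((p : ℝ≥0∞) ^ (-n)) • haar p := by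
  rw [map_dil_haar', haar_U]

end

noncomputable section

variable {p : ℕ}

/-! ### Characters -/

/-- The pairing `∑_j x_j ω_{1-j}` with values in `ℤ/p`. -/
def pairing (x ω : Vilenkin p) : ZMod p := ∑ᶠ j : ℤ, x.coord j * ω.coord (1 - j)

theorem finite_support_pairing (x ω : Vilenkin p) :
    {j : ℤ | x.coord j ≠ 0 ∧ ω.coord (1 - j) ≠ 0}.Finite := by
  obtain ⟨k, hk⟩ := x.eventually_zero
  obtain ⟨l, hl⟩ := ω.eventually_zero
  refine (Set.finite_Icc k (1 - l)).subset fun j hj => ⟨?_, ?_⟩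
  · by_contra hlt; exact hj.1 (hk j (by omega))
  · by_contra hlt; exact hj.2 (hl _ (by omega))

theorem pairing_finite (x ω : Vilenkin p) :
    (Function.support fun j : ℤ => x.coord j * ω.coord (1 - j)).Finite :=
  (finite_support_pairing x ω).subset fun _ hj => ⟨left_ne_zero_of_mul hj, right_ne_zero_of_mul hj⟩

theorem pairing_add_left (x y ω : Vilenkin p) :
    pairing (x + y) ω = pairing x ω + pairing y ω := by
  simp only [pairing, coord_add, add_mul]
  exact finsum_add_distrib (pairing_finite x ω) (pairing_finite y ω)

theorem pairing_comm (x ω : Vilenkin p) : pairing x ω = pairing ω x := by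
  unfold pairing
  rw [← finsum_comp_equiv (Equiv.subLeft (1 : ℤ))]
  refine finsum_congr fun j => ?_
  simp [mul_comm]

theorem pairing_add_right (x y ω : Vilenkin p) :
    pairing ω (x + y) = pairing ω x + pairing ω y := by
  simp only [pairing_comm ω, pairing_add_left]

theorem pairing_dil (n : ℤ) (x ω : Vilenkin p) : pairing (dil n x) ω = pairing x (dil n ω) := by
  unfold pairing
  rw [← finsum_comp_equiv (Equiv.addRight n) (f := fun j => x.coord j * (dil n ω).coord (1 - j))]
  refine finsum_congr fun j => ?_
  simp only [coord_dil, Equiv.coe_addRight]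
  congr 2
  ring

theorem pairing_eq_zero {x ω : Vilenkin p} (h : ∀ j, x.coord j = 0 ∨ ω.coord (1 - j) = 0) :
    pairing x ω = 0 := by
  unfold pairing
  rw [finsum_eq_zero_of_forall_eq_zero]
  intro j
  rcases h j with h | h <;> simp [h]

theorem pairing_single (j : ℤ) (s : ZMod p) (ω : Vilenkin p) :
    pairing (single j s) ω = s * ω.coord (1 - j) := by
  unfold pairing
  rw [finsum_eq_single _ j]
  · simp [coord_single]
  · intro i hi; simp [coord_single, hi]

theorem delta_eq_single (l : ℕ) : delta p l = single 1 (l : ZMod p) := rfl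

theorem coord_delta (l : ℕ) (j : ℤ) : (delta p l).coord j = if j = 1 then (l : ZMod p) else 0 := rfl

theorem delta_mem_U (l : ℕ) : delta p l ∈ U p 0 := fun j hj => by
  rw [coord_delta, if_neg (by omega)]

variable [NeZero p]

/-- Replacing integer representatives by residues makes the exponent bilinear, which yields all the
character identities. -/
theorem chi_eq (x ω : Vilenkin p) : chi x ω = ZMod.stdAddChar (pairing x ω) := by
  have h1 : pairing x ω =
      ((∑ᶠ j : ℤ, (x.coord j).val * (ω.coord (1 - j)).val : ℕ) : ZMod p) := by
    have := (Nat.castAddMonoidHom (ZMod p)).map_finsum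
      (f := fun j : ℤ => (x.coord j).val * (ω.coord (1 - j)).val)
      ((finite_support_pairing x ω).subset fun j hj => by
        have := left_ne_zero_of_mul hj
        have := right_ne_zero_of_mul hj
        refine ⟨?_, ?_⟩ <;> (intro h0; simp_all))
    rw [Nat.coe_castAddMonoidHom] at this
    rw [this]
    simp [pairing]
  rw [h1, ← Int.cast_natCast, ZMod.stdAddChar_coe, chi]
  congr 1
  rw [Int.cast_natCast]
  ring

theorem chi_add_left (x y ω : Vilenkin p) : chi (x + y) ω = chi x ω * chi y ω := by
  simp [chi_eq, pairing_add_left, AddChar.map_add_eq_mul]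

theorem chi_comm (x ω : Vilenkin p) : chi x ω = chi ω x := by
  simp [chi_eq, pairing_comm x]

theorem chi_add_right (x y ω : Vilenkin p) : chi ω (x + y) = chi ω x * chi ω y := by
  simp [chi_eq, pairing_add_right, AddChar.map_add_eq_mul]

theorem chi_dil (n : ℤ) (x ω : Vilenkin p) : chi (dil n x) ω = chi x (dil n ω) := by
  simp [chi_eq, pairing_dil]

/-- For each `j` either `j ≤ l` or `1 - j ≤ -l`, so every term of the pairing has a zero factor. In
particular characters are locally constant. -/
theorem chi_eq_one_of_mem_U {l : ℤ} {x ω : Vilenkin p} (hx : x ∈ U p l) (hω : ω ∈ U p (-l)) :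
    chi x ω = 1 := by
  rw [chi_eq, pairing_eq_zero, AddChar.map_zero_eq_one]
  intro j
  rcases le_or_gt j l with hj | hj
  · exact Or.inl (hx j hj)
  · exact Or.inr (hω _ (by omega))

@[simp] theorem chi_zero_left (ω : Vilenkin p) : chi 0 ω = 1 := by
  rw [chi_eq, pairing_eq_zero (fun _ => Or.inl rfl), AddChar.map_zero_eq_one]

@[simp] theorem chi_zero_right (ω : Vilenkin p) : chi ω 0 = 1 := by
  rw [chi_comm, chi_zero_left]

@[simp] theorem norm_chi (x ω : Vilenkin p) : ‖chi x ω‖ = 1 := by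
  rw [chi_eq, ZMod.stdAddChar_apply, Circle.norm_coe]

theorem chi_mul_conj (x ω : Vilenkin p) : chi x ω * conj (chi x ω) = 1 := by
  rw [Complex.mul_conj']; simp

theorem chi_neg_right (x ω : Vilenkin p) : chi x (-ω) = conj (chi x ω) := by
  have h1 : chi x ω * chi x (-ω) = 1 := by rw [← chi_add_right]; simp
  have h0 : chi x ω ≠ 0 := norm_ne_zero_iff.1 (by simp)
  exact mul_left_cancel₀ h0 (h1.trans (chi_mul_conj x ω).symm)

theorem chi_single (j : ℤ) (s : ZMod p) (ω : Vilenkin p) :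
    chi (single j s) ω = ZMod.stdAddChar (s * ω.coord (1 - j)) := by
  rw [chi_eq, pairing_single]

theorem continuous_chi (ω : Vilenkin p) : Continuous fun x => chi x ω := by
  refine continuous_iff_continuousAt.2 fun x => ?_
  obtain ⟨l, hl⟩ := exists_mem_U ω
  refine (continuousAt_const (y := chi x ω)).congr ?_
  filter_upwards [(nhds_hasBasis x).mem_of_mem (i := -l) trivial] with y hy
  have h1 := chi_add_left (y - x) x ω
  rw [sub_add_cancel, chi_eq_one_of_mem_U hy (by simpa using hl), one_mul] at h1
  exact h1.symm

/-! ### Integration over `U_0` -/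

theorem setIntegral_U_add {E : Type*} [NormedAddCommGroup E] [NormedSpace ℝ E]
    (D : Vilenkin p → E) {u : Vilenkin p} (hu : u ∈ U p 0) :
    ∫ ω in (U p 0 : Set (Vilenkin p)), D (ω + u) ∂haar p =
      ∫ ω in (U p 0 : Set (Vilenkin p)), D ω ∂haar p := by
  have hm := (isOpen_U (p := p) 0).measurableSet
  rw [← integral_indicator hm, ← integral_indicator hm,
    ← integral_add_right_eq_self ((U p 0 : Set (Vilenkin p)).indicator D) u]
  congr 1 with ω
  have : ω + u ∈ (U p 0 : Set (Vilenkin p)) ↔ ω ∈ (U p 0 : Set (Vilenkin p)) :=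
    AddSubgroup.add_mem_cancel_right _ hu
  by_cases hω : ω ∈ (U p 0 : Set (Vilenkin p))
  · simp [Set.indicator_of_mem hω, Set.indicator_of_mem (this.2 hω)]
  · simp [Set.indicator_of_notMem hω, Set.indicator_of_notMem (mt this.1 hω)]

/-- Translation by an element of `U_0` on which the character is nontrivial preserves the integral
and multiplies it by a number different from 1. -/
theorem integral_chi_eq_zero {κ : Vilenkin p} (hκ : κ ∈ H p) (h0 : κ ≠ 0) :
    ∫ ω in (U p 0 : Set (Vilenkin p)), chi ω κ ∂haar p = 0 := by
  obtain ⟨j, hj⟩ : ∃ j, κ.coord j ≠ 0 := by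
    by_contra! hall
    exact h0 (ext fun j => by simpa using hall j)
  have hj0 : j ≤ 0 := by
    by_contra! hlt
    exact hj (hκ j hlt)
  have hu : single (1 - j) 1 ∈ U p 0 := fun i hi => by
    rw [coord_single, if_neg (by omega)]
  have h1 := setIntegral_U_add (fun ω => chi ω κ) hu
  simp only [chi_add_left] at h1
  rw [integral_mul_const, chi_single] at h1
  have h2 : ZMod.stdAddChar (1 * κ.coord (1 - (1 - j))) ≠ (1 : ℂ) := by
    rw [one_mul, sub_sub_cancel]
    intro h3
    exact hj (ZMod.injective_stdAddChar (h3.trans (AddChar.map_zero_eq_one _).symm))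
  by_contra hne
  exact h2 (mul_left_cancel₀ hne (h1.trans (mul_one _).symm))

open scoped Classical in
theorem integral_chi (κ : H p) :
    ∫ ω in (U p 0 : Set (Vilenkin p)), chi ω (κ : Vilenkin p) ∂haar p = if κ = 0 then 1 else 0 := by
  split_ifs with h0
  · subst h0
    simp [Measure.real, haar_U_zero]
  · exact integral_chi_eq_zero κ.2 (by simpa using h0)

theorem integrableOn_U {D : Vilenkin p → ℂ} (hD : Continuous D) :
    IntegrableOn D (U p 0 : Set (Vilenkin p)) (haar p) :=
  hD.continuousOn.integrableOn_compact (isCompact_U 0)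

/-! ### Walsh polynomials -/

theorem isWalshPolynomial_chi (κ : H p) :
    IsWalshPolynomial fun ω => chi ω (κ : Vilenkin p) := by
  obtain ⟨l, hl⟩ := exists_mem_U (κ : Vilenkin p)
  obtain ⟨α, -, e⟩ := exists_h_eq (n := (-l).toNat) κ.2 (U_anti (by omega) hl)
  exact Submodule.subset_span ⟨α, by rw [← e]; rfl⟩

theorem isWalshPolynomial_one : IsWalshPolynomial (1 : Vilenkin p → ℂ) := by
  have := isWalshPolynomial_chi (0 : H p)
  simp only [ZeroMemClass.coe_zero, chi_zero_right] at this
  exact this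

theorem IsWalshPolynomial.smul {f : Vilenkin p → ℂ} (c : ℂ) (hf : IsWalshPolynomial f) :
    IsWalshPolynomial (c • f) := Submodule.smul_mem _ c hf

theorem IsWalshPolynomial.add {f g : Vilenkin p → ℂ} (hf : IsWalshPolynomial f)
    (hg : IsWalshPolynomial g) : IsWalshPolynomial (f + g) := Submodule.add_mem _ hf hg

theorem IsWalshPolynomial.sum {ι : Type*} {s : Finset ι} {f : ι → Vilenkin p → ℂ}
    (hf : ∀ i ∈ s, IsWalshPolynomial (f i)) : IsWalshPolynomial (∑ i ∈ s, f i) :=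
  Submodule.sum_mem _ hf

theorem walsh_eq (α : ℕ) : walsh p α = fun ω => chi ω (h p α) := rfl

theorem IsWalshPolynomial.mul {f g : Vilenkin p → ℂ} (hf : IsWalshPolynomial f)
    (hg : IsWalshPolynomial g) : IsWalshPolynomial (f * g) := by
  refine Submodule.span_induction₂ (p := fun f g _ _ => IsWalshPolynomial (f * g))
    ?_ ?_ ?_ ?_ ?_ ?_ ?_ hf hg
  · rintro _ _ ⟨α, rfl⟩ ⟨β, rfl⟩
    have := isWalshPolynomial_chi (⟨h p α, h_mem_H α⟩ + ⟨h p β, h_mem_H β⟩ : H p)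
    convert this using 1
    ext ω
    simp [walsh_eq, chi_add_right]
  · intro g _; rw [zero_mul]; exact Submodule.zero_mem _
  · intro g _; rw [mul_zero]; exact Submodule.zero_mem _
  · intro x y z _ _ _ hx hy; rw [add_mul]; exact hx.add hy
  · intro x y z _ _ _ hx hy; rw [mul_add]; exact hx.add hy
  · intro r x y _ _ hx; rw [smul_mul_assoc]; exact hx.smul r
  · intro r x y _ _ hx; rw [mul_smul_comm]; exact hx.smul r

theorem IsWalshPolynomial.conj {f : Vilenkin p → ℂ} (hf : IsWalshPolynomial f) :
    IsWalshPolynomial fun ω => conj (f ω) := by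
  induction hf using Submodule.span_induction with
  | mem x hx =>
    obtain ⟨α, rfl⟩ := hx
    have := isWalshPolynomial_chi (-⟨h p α, h_mem_H α⟩ : H p)
    simpa [walsh_eq, chi_neg_right] using this
  | zero =>
    simp only [Pi.zero_apply, map_zero]
    exact Submodule.zero_mem _
  | add x y _ _ hx hy =>
    simp only [Pi.add_apply, map_add]
    exact hx.add hy
  | smul c x _ hx =>
    simp only [Pi.smul_apply, smul_eq_mul, map_mul]
    exact hx.smul (starRingEnd ℂ c)

theorem IsWalshPolynomial.comp_add {f : Vilenkin p → ℂ} (hf : IsWalshPolynomial f)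
    (u : Vilenkin p) : IsWalshPolynomial fun ω => f (ω + u) := by
  induction hf using Submodule.span_induction with
  | mem x hx =>
    obtain ⟨α, rfl⟩ := hx
    have := (isWalshPolynomial_chi (⟨h p α, h_mem_H α⟩ : H p)).smul (chi u (h p α))
    simp only [walsh_eq, chi_add_left]
    convert this using 2
    simp [mul_comm]
  | zero => exact Submodule.zero_mem _
  | add x y _ _ hx hy => exact hx.add hy
  | smul c x _ hx => exact hx.smul c

theorem IsWalshPolynomial.continuous {f : Vilenkin p → ℂ} (hf : IsWalshPolynomial f) :
    Continuous f := by
  induction hf using Submodule.span_induction with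
  | mem x hx =>
    obtain ⟨α, rfl⟩ := hx
    exact continuous_chi _
  | zero => exact continuous_const
  | add x y _ _ hx hy => exact hx.add hy
  | smul c x _ hx => exact hx.const_smul c

/-- The Walsh polynomial `∑_κ d_κ conj χ(·, κ)`. -/
def trigPoly (d : H p →₀ ℂ) (ω : Vilenkin p) : ℂ :=
  d.sum fun κ z => z * conj (chi ω (κ : Vilenkin p))

theorem isWalshPolynomial_trigPoly (d : H p →₀ ℂ) : IsWalshPolynomial (trigPoly d) := by
  have := IsWalshPolynomial.sum (s := d.support)
    fun κ _ => ((isWalshPolynomial_chi κ).conj).smul (d κ)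
  convert this using 1
  ext ω
  simp [trigPoly, Finsupp.sum]

theorem IsWalshPolynomial.exists_trigPoly {f : Vilenkin p → ℂ} (hf : IsWalshPolynomial f) :
    ∃ d : H p →₀ ℂ, f = trigPoly d := by
  induction hf using Submodule.span_induction with
  | mem x hx =>
    obtain ⟨α, rfl⟩ := hx
    refine ⟨Finsupp.single (-⟨h p α, h_mem_H α⟩) 1, ?_⟩
    ext ω
    simp [trigPoly, walsh_eq, chi_neg_right]
  | zero => exact ⟨0, by ext; simp [trigPoly]⟩
  | add x y _ _ hx hy =>
    obtain ⟨d, rfl⟩ := hx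
    obtain ⟨e, rfl⟩ := hy
    refine ⟨d + e, ?_⟩
    ext ω
    exact (Finsupp.sum_add_index' (by simp) (by simp [add_mul])).symm
  | smul c x _ hx =>
    obtain ⟨d, rfl⟩ := hx
    refine ⟨c • d, ?_⟩
    ext ω
    simp only [trigPoly, Pi.smul_apply, smul_eq_mul]
    rw [Finsupp.sum_smul_index' (by simp), Finsupp.mul_sum]
    simp [mul_assoc]

/-- The coefficients of a Walsh polynomial. -/
def coef (D : Vilenkin p → ℂ) (κ : H p) : ℂ :=
  ∫ ω in (U p 0 : Set (Vilenkin p)), D ω * chi ω (κ : Vilenkin p) ∂haar p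

open scoped Classical in
theorem coef_trigPoly (d : H p →₀ ℂ) (κ : H p) : coef (trigPoly d) κ = d κ := by
  have h1 : ∀ ω : Vilenkin p, trigPoly d ω * chi ω (κ : Vilenkin p) =
      ∑ β ∈ d.support, d β * chi ω ((κ - β : H p) : Vilenkin p) := fun ω => by
    simp only [trigPoly, Finsupp.sum, Finset.sum_mul]
    refine Finset.sum_congr rfl fun β _ => ?_
    rw [AddSubgroup.coe_sub, sub_eq_add_neg, chi_add_right, chi_neg_right]
    ring
  simp only [coef, h1]
  rw [integral_finsetSum _ fun β _ => (integrableOn_U (continuous_chi _)).const_mul _]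
  simp only [integral_const_mul, integral_chi, sub_eq_zero]
  rw [Finset.sum_eq_single κ]
  · simp
  · intro β _ hβ; simp [hβ.symm]
  · intro hκ; simpa using hκ

/-- Parseval for a finite expansion, indexed by all of `H` so that it can later be restricted to `A
H`. -/
theorem IsWalshPolynomial.hasSum_coef {D : Vilenkin p → ℂ} (hD : IsWalshPolynomial D) :
    HasSum (fun κ : H p => ‖coef D κ‖ ^ 2)
      (∫ ω in (U p 0 : Set (Vilenkin p)), ‖D ω‖ ^ 2 ∂haar p) := by
  obtain ⟨d, rfl⟩ := hD.exists_trigPoly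
  have hc := (isWalshPolynomial_trigPoly d).continuous
  have key : (∫ ω in (U p 0 : Set (Vilenkin p)), ‖trigPoly d ω‖ ^ 2 ∂haar p) =
      ∑ κ ∈ d.support, ‖d κ‖ ^ 2 := by
    apply Complex.ofReal_injective
    rw [← integral_complex_ofReal]
    have h1 : ∀ ω : Vilenkin p, ((‖trigPoly d ω‖ ^ 2 : ℝ) : ℂ) =
        ∑ κ ∈ d.support, d κ * conj (trigPoly d ω * chi ω (κ : Vilenkin p)) := fun ω => by
      push_cast
      rw [← Complex.mul_conj']
      conv_lhs => enter [1]; rw [trigPoly, Finsupp.sum]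
      rw [Finset.sum_mul]
      refine Finset.sum_congr rfl fun κ _ => ?_
      rw [map_mul]; ring
    simp only [h1]
    rw [integral_finsetSum]
    · push_cast
      refine Finset.sum_congr rfl fun κ _ => ?_
      rw [integral_const_mul, integral_conj, ← coef, coef_trigPoly, Complex.mul_conj']
    · intro κ _
      refine Integrable.const_mul (integrableOn_U ?_) _
      exact Complex.continuous_conj.comp (hc.mul (continuous_chi _))
  rw [key]
  simp only [coef_trigPoly]
  exact hasSum_sum_of_ne_finset_zero fun κ hκ => by simpa using hκ

end

noncomputable section

variable {p : ℕ}

/-! ### Functions of finitely many entries -/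

/-- The function `f` depends only on the entries with indices `1, …, n`. -/
def IsCylinder (n : ℕ) (f : Vilenkin p → ℂ) : Prop :=
  ∀ ω ω' : Vilenkin p, (∀ j : ℤ, 1 ≤ j → j ≤ n → ω.coord j = ω'.coord j) → f ω = f ω'

theorem IsCylinder.mono {n k : ℕ} (hnk : n ≤ k) {f : Vilenkin p → ℂ} (hf : IsCylinder n f) :
    IsCylinder k f :=
  fun ω ω' hω => hf ω ω' fun j h1 h2 => hω j h1 (h2.trans (by exact_mod_cast hnk))

variable [NeZero p]

theorem IsWalshPolynomial.exists_isCylinder {f : Vilenkin p → ℂ} (hf : IsWalshPolynomial f) :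
    ∃ n, IsCylinder n f := by
  induction hf using Submodule.span_induction with
  | mem x hx =>
    obtain ⟨α, rfl⟩ := hx
    obtain ⟨l, hl⟩ := exists_mem_U (h p α)
    refine ⟨(-l).toNat, fun ω ω' hω => ?_⟩
    simp only [walsh_eq]
    have h1 := chi_add_left (ω - ω') ω' (h p α)
    rw [sub_add_cancel] at h1
    rw [h1, chi_eq, pairing_eq_zero, AddChar.map_zero_eq_one, one_mul]
    intro j
    by_cases hj : 1 ≤ j ∧ j ≤ (-l).toNat
    · left; rw [coord_sub, hω j hj.1 hj.2, sub_self]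
    · right
      by_cases hj1 : 1 ≤ j
      · exact hl _ (by omega)
      · exact h_mem_H α _ (by omega)
  | zero => exact ⟨0, fun _ _ _ => rfl⟩
  | add x y _ _ hx hy =>
    obtain ⟨n, hn⟩ := hx
    obtain ⟨k, hk⟩ := hy
    refine ⟨max n k, fun ω ω' hω => ?_⟩
    simp only [Pi.add_apply, hn.mono (le_max_left n k) ω ω' hω, hk.mono (le_max_right n k) ω ω' hω]
  | smul c x _ hx =>
    obtain ⟨n, hn⟩ := hx
    exact ⟨n, fun ω ω' hω => by simp only [Pi.smul_apply, hn ω ω' hω]⟩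

/-- Fourier inversion on `ℤ/p`: the indicator is the average over `t` of the characters `t (ω_i -
s)`. -/
theorem isWalshPolynomial_indicator {i : ℤ} (hi : 1 ≤ i) (s : ZMod p) :
    IsWalshPolynomial fun ω => if ω.coord i = s then (1 : ℂ) else 0 := by
  have hH : ∀ t : ZMod p, single (1 - i) t ∈ H p := fun t j hj => by
    rw [coord_single, if_neg (by omega)]
  have := (IsWalshPolynomial.sum (s := (Finset.univ : Finset (ZMod p))) fun t _ =>
    (isWalshPolynomial_chi ⟨_, hH t⟩).smul (ZMod.stdAddChar (-(t * s)))).smul (p : ℂ)⁻¹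
  convert this using 1
  ext ω
  have h1 := AddChar.sum_mulShift (ω.coord i - s) (ZMod.isPrimitive_stdAddChar p)
  simp only [Pi.smul_apply, Finset.sum_apply, smul_eq_mul, chi_comm ω, chi_single,
    ← AddChar.map_add_eq_mul, sub_sub_cancel]
  have h2 : ∀ t : ZMod p, -(t * s) + t * ω.coord i = t * (ω.coord i - s) := fun t => by ring
  simp only [h2, h1, sub_eq_zero, ZMod.card]
  have hp0 : (p : ℂ) ≠ 0 := by exact_mod_cast NeZero.ne p
  split_ifs <;> simp [hp0]

theorem isWalshPolynomial_prod {ι : Type*} (s : Finset ι) {f : ι → Vilenkin p → ℂ}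
    (hf : ∀ i ∈ s, IsWalshPolynomial (f i)) : IsWalshPolynomial (∏ i ∈ s, f i) :=
  Finset.prod_induction f IsWalshPolynomial (fun _ _ h1 h2 => h1.mul h2) isWalshPolynomial_one hf

/-- Such a function is a finite combination of products of one-entry indicators. Walsh polynomials
are thereby stable under arbitrary pointwise operations, square roots included, which the extension
of the mask requires. -/
theorem IsCylinder.isWalshPolynomial {n : ℕ} {f : Vilenkin p → ℂ} (hf : IsCylinder n f) :
    IsWalshPolynomial f := by
  let pt : (Fin n → ZMod p) → Vilenkin p := fun s => ∑ i : Fin n, single ((i : ℤ) + 1) (s i)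
  have hpt : ∀ (s : Fin n → ZMod p) (i : Fin n), (pt s).coord ((i : ℤ) + 1) = s i := by
    intro s i
    have h1 : ∀ (t : Finset (Fin n)) (j : ℤ), (∑ i ∈ t, single ((i : ℤ) + 1) (s i)).coord j =
        ∑ i ∈ t, (single ((i : ℤ) + 1) (s i)).coord j := fun t j => by
      classical
      induction t using Finset.induction_on with
      | empty => simp
      | insert a t ha ih => rw [Finset.sum_insert ha, Finset.sum_insert ha, coord_add, ih]
    rw [h1, Finset.sum_eq_single i]
    · simp [coord_single]
    · intro b _ hb
      rw [coord_single, if_neg]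
      intro h2
      exact hb (Fin.ext (by omega))
    · simp
  have key : f = ∑ s : Fin n → ZMod p, f (pt s) •
      ∏ i : Fin n, fun ω : Vilenkin p => if ω.coord ((i : ℤ) + 1) = s i then (1 : ℂ) else 0 := by
    ext ω
    simp only [Finset.sum_apply, Pi.smul_apply, Finset.prod_apply, smul_eq_mul]
    rw [Finset.sum_eq_single fun i : Fin n => ω.coord ((i : ℤ) + 1)]
    · simp only [if_true, Finset.prod_const_one, mul_one]
      refine hf _ _ fun j h1 h2 => ?_
      have := hpt (fun i : Fin n => ω.coord ((i : ℤ) + 1)) ⟨(j - 1).toNat, by omega⟩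
      have e : ((j - 1).toNat : ℤ) + 1 = j := by omega
      simp only [e] at this
      exact this.symm
    · intro s _ hs
      obtain ⟨i, hi⟩ := Function.ne_iff.1 hs
      rw [Finset.prod_eq_zero (Finset.mem_univ i) (if_neg (Ne.symm hi)), mul_zero]
    · simp
  rw [key]
  exact IsWalshPolynomial.sum fun s _ => (isWalshPolynomial_prod _ fun i _ =>
    isWalshPolynomial_indicator (by omega) _).smul _

/-! ### Unitary extension of a mask -/

omit [NeZero p] in
theorem maskMatrix_mul_conjTranspose_eq_one_iff {r : ℕ} {m : Fin (r + 1) → Vilenkin p → ℂ}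
    {ω : Vilenkin p} : maskMatrix m ω * (maskMatrix m ω).conjTranspose = 1 ↔
      ∀ l l' : Fin p, ∑ ν, m ν (ω + delta p l) * conj (m ν (ω + delta p l')) =
        if l = l' then 1 else 0 := by
  rw [← Matrix.ext_iff]
  simp [Matrix.mul_apply, maskMatrix, Matrix.one_apply]

/-- If the rows of a matrix are orthonormal, then its columns have norm at most one. -/
theorem sum_norm_sq_col_le_one {k n : Type*} [Fintype k] [DecidableEq k] [Fintype n]
    (M : Matrix k n ℂ) (hM : M * M.conjTranspose = 1) (j : n) : ∑ i, ‖M i j‖ ^ 2 ≤ 1 := by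
  set x : ℝ := ∑ i, ‖M i j‖ ^ 2 with hx
  -- `P` is a self-adjoint projection, so `P_jj = ∑_i |P_ji|² ≥ P_jj²`, which forces `P_jj ≤ 1`; and
  -- `P_jj` is the squared norm of column `j`.
  let P := M.conjTranspose * M
  have hPP : P * P = P := by
    change M.conjTranspose * M * (M.conjTranspose * M) = _
    rw [Matrix.mul_assoc, ← Matrix.mul_assoc M, hM, Matrix.one_mul]
  have hPs : ∀ i, P i j = conj (P j i) := fun i => by
    simp [P, Matrix.mul_apply, mul_comm]
  have hPj : P j j = x := by
    simp only [P, Matrix.mul_apply, Matrix.conjTranspose_apply, hx]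
    push_cast
    exact Finset.sum_congr rfl fun i _ => Complex.conj_mul' _
  have h1 : x = ∑ i, ‖P j i‖ ^ 2 := by
    apply Complex.ofReal_injective
    rw [← hPj, ← hPP, Matrix.mul_apply]
    push_cast
    exact Finset.sum_congr rfl fun i _ => by rw [hPs, Complex.mul_conj', hPP]
  have h2 : x ^ 2 ≤ x := by
    conv_rhs => rw [h1]
    have := Finset.single_le_sum (f := fun i => ‖P j i‖ ^ 2) (fun i _ => by positivity)
      (Finset.mem_univ j)
    refine le_trans (le_of_eq ?_) this
    simp [hPj]
  nlinarith

/-- Replacement of the entry with index `1`. -/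
def setFirst (ω : Vilenkin p) (s : ZMod p) : Vilenkin p := ω + single 1 (s - ω.coord 1)

omit [NeZero p] in
theorem coord_setFirst (ω : Vilenkin p) (s : ZMod p) (j : ℤ) :
    (setFirst ω s).coord j = if j = 1 then s else ω.coord j := by
  simp only [setFirst, coord_add, coord_single]
  split_ifs with hj
  · subst hj; ring
  · simp

omit [NeZero p] in
theorem setFirst_add_delta (ω : Vilenkin p) (l : ℕ) (s : ZMod p) :
    setFirst (ω + delta p l) s = setFirst ω s := by
  ext j
  simp only [coord_setFirst, coord_add, coord_delta]
  split_ifs <;> simp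

omit [NeZero p] in
theorem add_delta_eq_setFirst (ω : Vilenkin p) (l : ℕ) :
    ω + delta p l = setFirst ω (ω.coord 1 + l) := by
  simp [setFirst, delta_eq_single]

theorem sum_range_eq_sum_setFirst {M : Type*} [AddCommMonoid M] (f : Vilenkin p → M)
    (ω : Vilenkin p) :
    ∑ l ∈ Finset.range p, f (ω + delta p l) = ∑ s : ZMod p, f (setFirst ω s) := by
  refine Finset.sum_nbij' (fun l : ℕ => ω.coord 1 + (l : ZMod p))
    (fun s => (s - ω.coord 1).val) ?_ ?_ ?_ ?_ ?_
  · simp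
  · intro s _; simpa using ZMod.val_lt (s - ω.coord 1)
  · intro l hl
    simp only [add_sub_cancel_left]
    exact ZMod.val_cast_of_lt (by simpa using hl)
  · simp
  · intro l _; rw [add_delta_eq_setFirst]

theorem sum_zmod_eq_sum_fin {M : Type*} [AddCommMonoid M] (f : ZMod p → M) :
    ∑ ν : Fin p, f ((ν : ℕ) : ZMod p) = ∑ s, f s := by
  rw [Fin.sum_univ_eq_sum_range (fun l => f (l : ZMod p))]
  refine Finset.sum_nbij' (fun l : ℕ => (l : ZMod p)) (fun s => s.val) ?_ ?_ ?_ ?_ ?_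
  · simp
  · intro s _; simpa using ZMod.val_lt s
  · intro l hl; exact ZMod.val_cast_of_lt (by simpa using hl)
  · simp
  · simp

/-- With `v` the vector of values of `m₀` on the fibre `ω ⊕ δ_l`, the extension is `(v | I - c v
v*)`: its `p` additional columns form a positive square root of `I - v v*`. Both `c` and the
labelling by the first entry are independent of the chosen point of the fibre. -/
theorem exists_wavelet_masks {m₀ : Vilenkin p → ℂ} (hm : IsWalshPolynomial m₀)
    (hsum : ∀ ω, ∑ l ∈ Finset.range p, ‖m₀ (ω + delta p l)‖ ^ 2 ≤ 1) :
    ∃ m : Fin p → Vilenkin p → ℂ, (∀ ν, IsWalshPolynomial (m ν)) ∧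
      ∀ ω, maskMatrix (Fin.cons m₀ m : Fin (p + 1) → Vilenkin p → ℂ) ω *
        (maskMatrix (Fin.cons m₀ m : Fin (p + 1) → Vilenkin p → ℂ) ω).conjTranspose = 1 := by
  obtain ⟨n, hn⟩ := hm.exists_isCylinder
  let σ : Vilenkin p → ℝ := fun ω => ∑ s : ZMod p, ‖m₀ (setFirst ω s)‖ ^ 2
  -- A root of `σ c² - 2 c + 1 = 0`, written without division by `σ` so that it also covers `σ = 0`.
  let c : Vilenkin p → ℝ := fun ω => (1 + √(1 - σ ω))⁻¹
  have hσ : ∀ ω, σ ω ≤ 1 := fun ω => by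
    simpa only [sum_range_eq_sum_setFirst (fun ω => ‖m₀ ω‖ ^ 2)] using hsum ω
  have hc : ∀ ω, c ω ^ 2 * σ ω = 2 * c ω - 1 := fun ω => by
    have h1 := Real.sq_sqrt (sub_nonneg.2 (hσ ω))
    have h2 : 0 < 1 + √(1 - σ ω) := by positivity
    simp only [c]
    field_simp
    linarith
  let m : Fin p → Vilenkin p → ℂ := fun ν ω =>
    (if ω.coord 1 = ((ν : ℕ) : ZMod p) then 1 else 0) -
      c ω * m₀ ω * conj (m₀ (setFirst ω ((ν : ℕ) : ZMod p)))
  refine ⟨m, fun ν => ?_, fun ω => ?_⟩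
  -- One more than `n`, so that the entry with index 1 is included even when `m₀` is constant and `n
  -- = 0`.
  · refine IsCylinder.isWalshPolynomial (n := n + 1) fun ω ω' hω => ?_
    have hn' := hn.mono n.le_succ
    have h1 : ∀ s, m₀ (setFirst ω s) = m₀ (setFirst ω' s) := fun s =>
      hn' _ _ fun j hj1 hj2 => by rw [coord_setFirst, coord_setFirst, hω j hj1 hj2]
    simp only [m, c, σ, h1, hn' ω ω' hω, hω 1 le_rfl (by push_cast; omega)]
  · rw [maskMatrix_mul_conjTranspose_eq_one_iff]
    intro l l'
    rw [Fin.sum_univ_succ]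
    simp only [Fin.cons_zero, Fin.cons_succ, m]
    have hc1 : ∀ l, c (ω + delta p l) = c ω := fun l => by
      simp only [c, σ, setFirst_add_delta]
    simp only [hc1, setFirst_add_delta]
    rw [sum_zmod_eq_sum_fin (fun s : ZMod p =>
      ((if (ω + delta p l).coord 1 = s then 1 else 0) -
        (c ω : ℂ) * m₀ (ω + delta p l) * conj (m₀ (setFirst ω s))) *
      conj ((if (ω + delta p l').coord 1 = s then 1 else 0) -
        (c ω : ℂ) * m₀ (ω + delta p l') * conj (m₀ (setFirst ω s))))]
    simp only [add_delta_eq_setFirst ω, coord_setFirst, if_true]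
    set a := ω.coord 1 + ((l : ℕ) : ZMod p) with ha
    set b := ω.coord 1 + ((l' : ℕ) : ZMod p) with hb
    set v : ZMod p → ℂ := fun s => m₀ (setFirst ω s) with hv
    have hab : (a = b) ↔ l = l' := by
      rw [ha, hb, add_right_inj, ZMod.natCast_eq_natCast_iff', Nat.mod_eq_of_lt l.2,
        Nat.mod_eq_of_lt l'.2, Fin.ext_iff]
    have hs : ∑ s, v s * conj (v s) = (σ ω : ℂ) := by
      simp only [σ, Complex.mul_conj', hv]
      push_cast
      rfl
    have hcC : (c ω : ℂ) ^ 2 * σ ω = 2 * c ω - 1 := by exact_mod_cast hc ω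
    have expand : ∀ s : ZMod p, ((if a = s then (1 : ℂ) else 0) - c ω * v a * conj (v s)) *
        conj ((if b = s then (1 : ℂ) else 0) - c ω * v b * conj (v s)) =
        (if a = s then (if b = s then (1 : ℂ) else 0) else 0) -
        (if a = s then c ω * conj (v b) * v s else 0) -
        (if b = s then c ω * v a * conj (v s) else 0) +
        (c ω : ℂ) ^ 2 * v a * conj (v b) * (v s * conj (v s)) := fun s => by
      simp only [map_sub, map_mul, Complex.conj_ofReal, Complex.conj_conj]
      split_ifs <;> simp <;> ring
    change v a * conj (v b) + ∑ s, ((if a = s then (1 : ℂ) else 0) - c ω * v a * conj (v s)) *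
        conj ((if b = s then (1 : ℂ) else 0) - c ω * v b * conj (v s)) = _
    simp only [expand, Finset.sum_add_distrib, Finset.sum_sub_distrib, ← Finset.mul_sum, hs,
      Finset.sum_ite_eq, Finset.mem_univ, if_true]
    simp only [← hab, eq_comm (a := b)]
    -- All terms except the identity matrix collect to `v_a conj(v_b) (1 - 2c + c² σ)`.
    linear_combination v a * conj (v b) * hcC

end

noncomputable section

variable {p : ℕ} [NeZero p]

/-! ### Perfect reconstruction of the filter bank -/

/-- The average of `D` over the translates by `δ_l`. -/
def avgDelta (D : Vilenkin p → ℂ) (ω : Vilenkin p) : ℂ := (p : ℂ)⁻¹ * ∑ l : Fin p, D (ω + delta p l)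

theorem IsWalshPolynomial.avgDelta {D : Vilenkin p → ℂ} (hD : IsWalshPolynomial D) :
    IsWalshPolynomial (avgDelta D) := by
  have := (IsWalshPolynomial.sum (s := (Finset.univ : Finset (Fin p)))
    fun l _ => hD.comp_add (delta p l)).smul (p : ℂ)⁻¹
  convert this using 1
  ext ω
  simp [Vilenkin.avgDelta]

/-- Characters with frequency in `A H` are trivial on the `δ_l`, so each translate contributes the
same coefficient. -/
theorem coef_avgDelta {D : Vilenkin p → ℂ} (hD : Continuous D) (k : H p) :
    coef (avgDelta D) (dilH k) = coef D (dilH k) := by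
  have hp0 : (p : ℂ) ≠ 0 := by exact_mod_cast NeZero.ne p
  have h0 : (dilH k : Vilenkin p).coord 0 = 0 := mem_range_dilH.1 ⟨k, rfl⟩
  have h1 : ∀ ω : Vilenkin p, avgDelta D ω * chi ω (dilH k : Vilenkin p) =
      ∑ l : Fin p, (p : ℂ)⁻¹ *
        (D (ω + delta p l) * chi (ω + delta p l) (dilH k : Vilenkin p)) := fun ω => by
    rw [avgDelta, mul_assoc, Finset.sum_mul, Finset.mul_sum]
    refine Finset.sum_congr rfl fun l _ => ?_
    rw [chi_add_left _ (delta p l), delta_eq_single, chi_single, sub_self, h0, mul_zero,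
      AddChar.map_zero_eq_one, mul_one]
  have hc : ∀ u : Vilenkin p, Continuous fun ω => D (ω + u) * chi (ω + u) (dilH k : Vilenkin p) :=
    fun u => (hD.mul (continuous_chi _)).comp (continuous_add_const u)
  simp only [coef, h1]
  rw [integral_finsetSum _ fun l _ => (integrableOn_U (hc _)).const_mul _]
  simp only [integral_const_mul]
  have h2 : ∀ l : Fin p, ∫ ω in (U p 0 : Set (Vilenkin p)),
      D (ω + delta p l) * chi (ω + delta p l) (dilH k : Vilenkin p) ∂haar p =
      ∫ ω in (U p 0 : Set (Vilenkin p)), D ω * chi ω (dilH k : Vilenkin p) ∂haar p := fun l =>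
    setIntegral_U_add (fun ω => D ω * chi ω (dilH k : Vilenkin p)) (delta_mem_U l)
  simp only [h2, Finset.sum_const, Finset.card_univ, Fintype.card_fin, nsmul_eq_mul]
  rw [mul_inv_cancel_left₀ hp0]

/-- The sequence `k ↦ √p ∑_α conj a_α c(A k + α)`. -/
def analysisFilter (a : H p →₀ ℂ) (c : H p → ℂ) (k : H p) : ℂ :=
  (√(p : ℝ) : ℂ) * a.sum fun α z => conj z * c (dilH k + α)

/-- Multiplication by the conjugate of a mask is correlation of coefficients; at `κ = A k` this is
`analysisFilter` without its factor `√p`. -/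
theorem coef_mul_conj_trigPoly (a c : H p →₀ ℂ) (κ : H p) :
    coef (fun ω => trigPoly c ω * conj (trigPoly a ω)) κ =
      a.sum fun α z => conj z * c (κ + α) := by
  have h1 : ∀ ω : Vilenkin p, trigPoly c ω * conj (trigPoly a ω) * chi ω (κ : Vilenkin p) =
      ∑ α ∈ a.support, conj (a α) * (trigPoly c ω * chi ω ((κ + α : H p) : Vilenkin p)) := by
    intro ω
    conv_lhs => rw [trigPoly.eq_1 a, Finsupp.sum, map_sum, Finset.mul_sum, Finset.sum_mul]
    refine Finset.sum_congr rfl fun α _ => ?_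
    rw [AddSubgroup.coe_add, chi_add_right, map_mul, Complex.conj_conj]
    ring
  simp only [coef, h1]
  have hint : ∀ κ : H p, IntegrableOn (fun ω => trigPoly c ω * chi ω (κ : Vilenkin p))
      (U p 0 : Set (Vilenkin p)) (haar p) := fun κ =>
    integrableOn_U ((isWalshPolynomial_trigPoly c).continuous.mul (continuous_chi _))
  rw [integral_finsetSum _ fun α _ => (hint _).const_mul _]
  simp only [integral_const_mul]
  exact Finset.sum_congr rfl fun α _ => by rw [← coef, coef_trigPoly]

/-- Downsampling to `A H` is averaging over the `δ_l` on the frequency side: the average keeps the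
coefficients in `A H` and has no others. Parseval for the average then gives the sum. -/
theorem hasSum_analysisFilter (a c : H p →₀ ℂ) :
    HasSum (fun k => ‖analysisFilter a c k‖ ^ 2)
      (∫ ω in (U p 0 : Set (Vilenkin p)),
        p * ‖avgDelta (fun ω => trigPoly c ω * conj (trigPoly a ω)) ω‖ ^ 2 ∂haar p) := by
  have hD : IsWalshPolynomial fun ω => trigPoly c ω * conj (trigPoly a ω) :=
    (isWalshPolynomial_trigPoly c).mul (isWalshPolynomial_trigPoly a).conj
  have h1 := hD.avgDelta.hasSum_coef
  have hz : ∀ κ ∉ Set.range (dilH : H p → H p),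
      ‖coef (avgDelta fun ω => trigPoly c ω * conj (trigPoly a ω)) κ‖ ^ 2 = 0 := by
    intro κ hκ
    rw [mem_range_dilH] at hκ
    -- translation by `δ_1` multiplies the coefficient by a number different from one
    have hinv : ∀ ω, avgDelta (fun ω => trigPoly c ω * conj (trigPoly a ω)) (ω + delta p 1) =
        avgDelta (fun ω => trigPoly c ω * conj (trigPoly a ω)) ω := fun ω => by
      simp only [avgDelta]
      congr 1
      rw [Fin.sum_univ_eq_sum_range (fun l => trigPoly c (ω + delta p 1 + delta p l) *
          conj (trigPoly a (ω + delta p 1 + delta p l))),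
        Fin.sum_univ_eq_sum_range (fun l => trigPoly c (ω + delta p l) *
          conj (trigPoly a (ω + delta p l))),
        sum_range_eq_sum_setFirst (fun ω => trigPoly c ω * conj (trigPoly a ω)),
        sum_range_eq_sum_setFirst (fun ω => trigPoly c ω * conj (trigPoly a ω))]
      simp only [setFirst_add_delta]
    have h2 := setIntegral_U_add (fun ω =>
      avgDelta (fun ω => trigPoly c ω * conj (trigPoly a ω)) ω * chi ω (κ : Vilenkin p))
      (delta_mem_U (p := p) 1)
    simp only [hinv, chi_add_left, ← mul_assoc] at h2
    rw [integral_mul_const, ← coef, delta_eq_single, chi_single, Nat.cast_one, one_mul,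
      sub_self] at h2
    have h3 : coef (avgDelta fun ω => trigPoly c ω * conj (trigPoly a ω)) κ = 0 := by
      by_contra hne
      have h4 := mul_left_cancel₀ hne (h2.trans (mul_one _).symm)
      exact hκ (ZMod.injective_stdAddChar (h4.trans (AddChar.map_zero_eq_one _).symm))
    simp [h3]
  have h2 := ((dilH_injective.hasSum_iff hz).2 h1).mul_left (p : ℝ)
  rw [integral_const_mul]
  have h3 : ∀ k, ‖analysisFilter a c k‖ ^ 2 =
      p * ‖coef (avgDelta fun ω => trigPoly c ω * conj (trigPoly a ω)) (dilH k)‖ ^ 2 := fun k => ?_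
  · rw [funext h3]
    exact h2
  rw [coef_avgDelta hD.continuous, coef_mul_conj_trigPoly, analysisFilter, norm_mul, mul_pow]
  congr 1
  rw [Complex.norm_real, Real.norm_eq_abs, sq_abs, Real.sq_sqrt (Nat.cast_nonneg _)]

/-- Expanding the squares gives a double sum over `l, l'`, in which orthonormality of the rows
leaves only the diagonal. -/
theorem sum_norm_sq_avgDelta {ι : Type*} [Fintype ι] {m : ι → Vilenkin p → ℂ}
    {ω : Vilenkin p} (F : Vilenkin p → ℂ)
    (hm : ∀ l l' : Fin p, ∑ ν, m ν (ω + delta p l) * conj (m ν (ω + delta p l')) =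
      if l = l' then 1 else 0) :
    ∑ ν, p * ‖avgDelta (fun ω => F ω * conj (m ν ω)) ω‖ ^ 2 =
      (p : ℝ)⁻¹ * ∑ l : Fin p, ‖F (ω + delta p l)‖ ^ 2 := by
  have hp0 : (p : ℂ) ≠ 0 := by exact_mod_cast NeZero.ne p
  apply Complex.ofReal_injective
  push_cast
  simp only [← Complex.mul_conj', avgDelta, map_mul, map_inv₀, map_sum, Complex.conj_conj,
    map_natCast]
  calc _ = (p : ℂ)⁻¹ * ∑ ν, ∑ l : Fin p, ∑ l' : Fin p,
        F (ω + delta p l) * conj (F (ω + delta p l')) *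
          (m ν (ω + delta p l') * conj (m ν (ω + delta p l))) := by
        rw [Finset.mul_sum]
        refine Finset.sum_congr rfl fun ν _ => ?_
        have h1 : ∀ X Y : ℂ, (p : ℂ) * ((p : ℂ)⁻¹ * X * ((p : ℂ)⁻¹ * Y)) = (p : ℂ)⁻¹ * (X * Y) := by
          intro X Y; field_simp
        rw [h1, Finset.sum_mul_sum]
        congr 1
        refine Finset.sum_congr rfl fun l _ => Finset.sum_congr rfl fun l' _ => ?_
        ring
    _ = (p : ℂ)⁻¹ * ∑ l : Fin p, ∑ l' : Fin p, F (ω + delta p l) * conj (F (ω + delta p l')) *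
          ∑ ν, (m ν (ω + delta p l') * conj (m ν (ω + delta p l))) := by
        rw [Finset.sum_comm]
        congr 1
        refine Finset.sum_congr rfl fun l _ => ?_
        rw [Finset.sum_comm]
        exact Finset.sum_congr rfl fun l' _ => (Finset.mul_sum _ _ _).symm
    _ = _ := by
        congr 1
        refine Finset.sum_congr rfl fun l _ => ?_
        simp [hm]

/-- An orthonormal system of masks gives a filter bank that preserves the `ℓ²` norm. -/
theorem exists_hasSum_analysisFilter {ι : Type*} [Fintype ι] (a : ι → H p →₀ ℂ) (c : H p →₀ ℂ)
    (ha : ∀ ω, ∀ l l' : Fin p, ∑ ν, trigPoly (a ν) (ω + delta p l) *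
      conj (trigPoly (a ν) (ω + delta p l')) = if l = l' then 1 else 0) :
    ∃ t : ι → ℝ, (∀ ν, HasSum (fun k => ‖analysisFilter (a ν) c k‖ ^ 2) (t ν)) ∧
      HasSum (fun κ => ‖c κ‖ ^ 2) (∑ ν, t ν) := by
  refine ⟨_, fun ν => hasSum_analysisFilter (a ν) c, ?_⟩
  have hF := isWalshPolynomial_trigPoly c
  have hint : ∀ f : Vilenkin p → ℂ, Continuous f →
      IntegrableOn (fun ω => ‖f ω‖ ^ 2) (U p 0 : Set (Vilenkin p)) (haar p) := fun f hf =>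
    (hf.norm.pow 2).continuousOn.integrableOn_compact (isCompact_U 0)
  have h1 := hF.hasSum_coef
  simp only [coef_trigPoly] at h1
  convert h1 using 1
  rw [← integral_finsetSum]
  -- The `p` translates have equal integrals over `U_0`, which cancels the factor `p⁻¹`.
  · simp only [fun ω => sum_norm_sq_avgDelta (trigPoly c) (ha ω)]
    rw [integral_const_mul, integral_finsetSum]
    · simp only [fun l : Fin p => setIntegral_U_add (fun ω => ‖trigPoly c ω‖ ^ 2)
        (delta_mem_U (p := p) l)]
      have hp0 : (p : ℝ) ≠ 0 := by exact_mod_cast NeZero.ne p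
      simp [hp0]
    · exact fun l _ => hint _ (hF.continuous.comp (continuous_add_const _))
  · exact fun ν _ => (hint _
      (IsWalshPolynomial.avgDelta (hF.mul (isWalshPolynomial_trigPoly _).conj)).continuous).const_mul _

end

noncomputable section

variable {p : ℕ} [NeZero p]

/-! ### Dilated translates -/

omit [NeZero p] in
theorem measurable_dil_sub (j : ℤ) (κ : Vilenkin p) :
    Measurable fun x : Vilenkin p => dil j x - κ := (measurable_dil j).sub_const κ

theorem map_dil_sub (j : ℤ) (κ : Vilenkin p) :
    (haar p).map (fun x => dil j x - κ) = ((p : ℝ≥0∞) ^ (-j)) • haar p := by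
  have h1 : (fun x : Vilenkin p => dil j x - κ) = (fun y => y + -κ) ∘ dil j := by
    ext1 x; simp [sub_eq_add_neg]
  rw [h1, ← Measure.map_map (measurable_add_const _) (measurable_dil j), map_dil_haar,
    Measure.map_smul, map_add_right_eq_self]

omit [NeZero p] in
theorem measurableEmbedding_dil_sub (j : ℤ) (κ : Vilenkin p) :
    MeasurableEmbedding fun x : Vilenkin p => dil j x - κ :=
  ((dilHomeo p j).trans (Homeomorph.subRight κ)).measurableEmbedding

theorem pow_ne_top (j : ℤ) : (p : ℝ≥0∞) ^ j ≠ ⊤ :=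
  ENNReal.zpow_ne_top (by exact_mod_cast NeZero.ne p) (ENNReal.natCast_ne_top p) j

omit [NeZero p] in
theorem toReal_pow (j : ℤ) : ((p : ℝ≥0∞) ^ j).toReal = (p : ℝ) ^ j := by
  cases j with
  | ofNat n => simp
  | negSucc n => simp [zpow_negSucc]

theorem integral_dil_sub {E : Type*} [NormedAddCommGroup E] [NormedSpace ℝ E]
    (f : Vilenkin p → E) (j : ℤ) (κ : Vilenkin p) :
    ∫ x, f (dil j x - κ) ∂haar p = ((p : ℝ) ^ (-j)) • ∫ x, f x ∂haar p := by
  rw [← (measurableEmbedding_dil_sub j κ).integral_map f, map_dil_sub, integral_smul_measure,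
    toReal_pow]

theorem _root_.MeasureTheory.MemLp.comp_dil_sub {f : Vilenkin p → ℂ} {q : ℝ≥0∞}
    (hf : MemLp f q (haar p))
    (j : ℤ) (κ : Vilenkin p) : MemLp (fun x => f (dil j x - κ)) q (haar p) := by
  have h1 := hf.smul_measure (pow_ne_top (p := p) (-j))
  rw [← map_dil_sub j κ] at h1
  exact h1.comp_of_map (measurable_dil_sub j κ).aemeasurable

theorem quasiMeasurePreserving_dil_sub (j : ℤ) (κ : Vilenkin p) :
    Measure.QuasiMeasurePreserving (fun x : Vilenkin p => dil j x - κ) (haar p) (haar p) :=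
  ⟨measurable_dil_sub j κ, by rw [map_dil_sub]; exact Measure.smul_absolutelyContinuous⟩

/-- The functions `p^(j/2) f(A^j x ⊖ κ)`. -/
def dilTranslate (f : Vilenkin p → ℂ) (j : ℤ) (κ x : Vilenkin p) : ℂ :=
  (((p : ℝ) ^ ((j : ℝ) / 2) : ℝ) : ℂ) * f (dil j x - κ)

theorem _root_.MeasureTheory.MemLp.dilTranslate {f : Vilenkin p → ℂ} {q : ℝ≥0∞}
    (hf : MemLp f q (haar p))
    (j : ℤ) (κ : Vilenkin p) : MemLp (dilTranslate f j κ) q (haar p) :=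
  (hf.comp_dil_sub j κ).const_mul _

omit [NeZero p] in
theorem dilTranslate_zero (f : Vilenkin p → ℂ) : dilTranslate f 0 0 = f := by
  ext x; simp [dilTranslate]

theorem dilTranslate_congr_ae {f g : Vilenkin p → ℂ} (hfg : f =ᵐ[haar p] g) (j : ℤ)
    (κ : Vilenkin p) : dilTranslate f j κ =ᵐ[haar p] dilTranslate g j κ := by
  filter_upwards [(quasiMeasurePreserving_dil_sub j κ).ae_eq_comp hfg] with x hx
  have : f (dil j x - κ) = g (dil j x - κ) := hx
  rw [dilTranslate, dilTranslate, this]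

/-! ### The inner product -/

/-- The inner product of `L²(G)`, linear in the first argument. -/
def ip (f g : Vilenkin p → ℂ) : ℂ := ∫ x, f x * conj (g x) ∂haar p

theorem inner_toLp {f g : Vilenkin p → ℂ} (hf : MemLp f 2 (haar p)) (hg : MemLp g 2 (haar p)) :
    inner ℂ (hg.toLp g) (hf.toLp f) = ip f g := by
  rw [L2.inner_def, ip]
  refine integral_congr_ae ?_
  filter_upwards [hf.coeFn_toLp, hg.coeFn_toLp] with x h1 h2
  rw [h1, h2]
  simp

theorem norm_toLp_sq {f : Vilenkin p → ℂ} (hf : MemLp f 2 (haar p)) :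
    ‖hf.toLp f‖ ^ 2 = ∫ x, ‖f x‖ ^ 2 ∂haar p := by
  have h1 := inner_self_eq_norm_sq_to_K (𝕜 := ℂ) (hf.toLp f)
  rw [inner_toLp] at h1
  apply Complex.ofReal_injective
  rw [← integral_complex_ofReal]
  simp only [ip, Complex.mul_conj'] at h1
  push_cast
  exact h1.symm

theorem norm_ip_sq_le {f g : Vilenkin p → ℂ} (hf : MemLp f 2 (haar p))
    (hg : MemLp g 2 (haar p)) :
    ‖ip f g‖ ^ 2 ≤ (∫ x, ‖f x‖ ^ 2 ∂haar p) * ∫ x, ‖g x‖ ^ 2 ∂haar p := by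
  rw [← inner_toLp hf hg, ← norm_toLp_sq hf, ← norm_toLp_sq hg, ← mul_pow, mul_comm ‖hf.toLp f‖]
  exact pow_le_pow_left₀ (norm_nonneg _) (norm_inner_le_norm _ _) 2

theorem ip_congr_right {f g g' : Vilenkin p → ℂ} (hg : g =ᵐ[haar p] g') : ip f g = ip f g' := by
  refine integral_congr_ae ?_
  filter_upwards [hg] with x hx
  rw [hx]

theorem integrable_mul_conj {f g : Vilenkin p → ℂ} (hf : MemLp f 2 (haar p))
    (hg : MemLp g 2 (haar p)) : Integrable (fun x => f x * conj (g x)) (haar p) := by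
  exact hf.integrable_mul (q := 2) hg.star

/-! ### Synthesis -/

/-- The function `p ∑_α a_α f(A x ⊖ α)`. -/
def synth (a : H p →₀ ℂ) (f : Vilenkin p → ℂ) (x : Vilenkin p) : ℂ :=
  p * a.sum fun α z => z * f (dil 1 x - α)

theorem _root_.MeasureTheory.MemLp.synth {f : Vilenkin p → ℂ} {q : ℝ≥0∞} (hf : MemLp f q (haar p))
    (a : H p →₀ ℂ) : MemLp (synth a f) q (haar p) := by
  have h1 := (memLp_finsetSum a.support
    fun α (_ : α ∈ a.support) => (hf.comp_dil_sub 1 (α : Vilenkin p)).const_mul (a α)).const_mul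
      (p : ℂ)
  exact h1

/-- The two-scale relation: `A(A^j x ⊖ κ) ⊖ α = A^(j+1) x ⊖ (Aκ ⊕ α)`, and `p^(j/2) p = √p
p^((j+1)/2)`. -/
theorem dilTranslate_synth (a : H p →₀ ℂ) (f : Vilenkin p → ℂ) (j : ℤ) (κ x : Vilenkin p) :
    dilTranslate (synth a f) j κ x = (√(p : ℝ) : ℂ) *
      a.sum fun α z => z * dilTranslate f (j + 1) (dil 1 κ + α) x := by
  have hp0 : (0 : ℝ) < p := by exact_mod_cast NeZero.pos p
  have h1 : (p : ℝ) ^ ((j : ℝ) / 2) * p = √(p : ℝ) * (p : ℝ) ^ (((j + 1 : ℤ) : ℝ) / 2) := by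
    rw [Real.sqrt_eq_rpow, ← Real.rpow_add hp0]
    nth_rewrite 2 [← Real.rpow_one (p : ℝ)]
    rw [← Real.rpow_add hp0]
    congr 1
    push_cast
    ring
  have h2 : (((p : ℝ) ^ ((j : ℝ) / 2) : ℝ) : ℂ) * p =
      (√(p : ℝ) : ℂ) * (((p : ℝ) ^ (((j + 1 : ℤ) : ℝ) / 2) : ℝ) : ℂ) := by exact_mod_cast h1
  simp only [dilTranslate, synth, Finsupp.sum]
  rw [← mul_assoc, h2, mul_assoc, Finset.mul_sum]
  congr 1
  refine Finset.sum_congr rfl fun α _ => ?_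
  rw [dil_sub, dil_dil, add_comm 1 j, sub_sub]
  ring

/-- Coefficients at scale `j` are filtered coefficients at scale `j + 1`; this turns the frame
problem into one about the filter bank. -/
theorem ip_dilTranslate_synth {f g : Vilenkin p → ℂ} (hf : MemLp f 2 (haar p))
    (hg : MemLp g 2 (haar p)) (a : H p →₀ ℂ) (j : ℤ) (κ : H p) :
    ip f (dilTranslate (synth a g) j κ) =
      analysisFilter a (fun β : H p => ip f (dilTranslate g (j + 1) β)) κ := by
  have h1 : ∀ x, f x * conj (dilTranslate (synth a g) j κ x) =
      ∑ α ∈ a.support, (√(p : ℝ) : ℂ) * conj (a α) *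
        (f x * conj (dilTranslate g (j + 1) (dilH κ + α : H p) x)) := fun x => by
    rw [dilTranslate_synth, Finsupp.sum, map_mul, map_sum, Finset.mul_sum, Finset.mul_sum]
    refine Finset.sum_congr rfl fun α _ => ?_
    rw [map_mul, Complex.conj_ofReal, AddSubgroup.coe_add, coe_dilH]
    ring
  simp only [ip, h1]
  rw [integral_finsetSum _ fun α _ =>
    (integrable_mul_conj hf (hg.dilTranslate _ _)).const_mul _]
  simp only [integral_const_mul, analysisFilter, Finsupp.sum, Finset.mul_sum, mul_assoc]

/-- Shows that the wavelets built as finite sums on the time side satisfy the prescribed equation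
for their transforms; the factor `p` cancels the Jacobian of `A`. -/
theorem fourier_synth {f : Vilenkin p → ℂ} (hf : Integrable f (haar p)) (a : H p →₀ ℂ)
    (ω : Vilenkin p) :
    fourier (synth a f) ω = trigPoly a (dil (-1) ω) * fourier f (dil (-1) ω) := by
  have hp0 : (p : ℂ) ≠ 0 := by exact_mod_cast NeZero.ne p
  have hI : Integrable (fun x => f x * conj (chi x (dil (-1) ω))) (haar p) := by
    refine hf.mul_bdd (c := 1) (Complex.continuous_conj.comp
      (continuous_chi _)).aestronglyMeasurable (Eventually.of_forall fun x => ?_)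
    simp
  have h1 : ∀ x, synth a f x * conj (chi x ω) = ∑ α ∈ a.support,
      (p : ℂ) * a α * conj (chi (dil (-1) ω) (α : Vilenkin p)) *
        (f (dil 1 x - α) * conj (chi (dil 1 x - (α : Vilenkin p)) (dil (-1) ω))) := fun x => by
    rw [synth, Finsupp.sum, mul_assoc, Finset.sum_mul, Finset.mul_sum]
    refine Finset.sum_congr rfl fun α _ => ?_
    have h2 : chi x ω = chi (dil (-1) ω) (α : Vilenkin p) *
        chi (dil 1 x - (α : Vilenkin p)) (dil (-1) ω) := by
      rw [chi_comm (dil (-1) ω), ← chi_add_left, add_sub_cancel, ← chi_dil, dil_dil]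
      simp
    rw [h2, map_mul]
    ring
  simp only [fourier, h1]
  rw [integral_finsetSum]
  · simp only [integral_const_mul]
    rw [trigPoly, Finsupp.sum, Finset.sum_mul]
    refine Finset.sum_congr rfl fun α _ => ?_
    rw [integral_dil_sub (fun x => f x * conj (chi x (dil (-1) ω)))]
    rw [Complex.real_smul, zpow_neg, zpow_one, Complex.ofReal_inv, Complex.ofReal_natCast]
    field_simp
  · intro α _
    refine Integrable.const_mul ?_ _
    have := (memLp_one_iff_integrable.2 hI).comp_dil_sub 1 (α : Vilenkin p)
    exact memLp_one_iff_integrable.1 this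

theorem integral_synth {f : Vilenkin p → ℂ} (hf : Integrable f (haar p)) (a : H p →₀ ℂ) :
    ∫ x, synth a f x ∂haar p = trigPoly a 0 * ∫ x, f x ∂haar p := by
  have h1 := fourier_synth hf a 0
  have h0 : dil (-1) (0 : Vilenkin p) = 0 := by ext; simp
  simpa [fourier, h0] using h1

theorem hasCompactSupport_of_subset {f : Vilenkin p → ℂ} {l : ℤ}
    (hf : ∀ x ∉ U p l, f x = 0) : HasCompactSupport f :=
  HasCompactSupport.intro (isCompact_U l) fun x hx => hf x hx

omit [NeZero p] in
theorem synth_eq_zero {f : Vilenkin p → ℂ} {N : ℕ} (hf : ∀ x ∉ U p (-N), f x = 0)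
    (a : H p →₀ ℂ) : ∃ L : ℕ, ∀ x ∉ U p (-L), synth a f x = 0 := by
  obtain ⟨L, hL⟩ : ∃ L : ℕ, ∀ α ∈ a.support, (α : Vilenkin p) ∈ U p (-L) := by
    choose l hl using fun α : H p => exists_mem_U (α : Vilenkin p)
    refine ⟨a.support.sup fun α => (-l α).toNat, fun α hα => U_anti ?_ (hl α)⟩
    have := Finset.le_sup (f := fun α => (-l α).toNat) hα
    omega
  refine ⟨N + L, fun x hx => ?_⟩
  rw [synth, Finsupp.sum, Finset.sum_eq_zero, mul_zero]
  intro α hα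
  rw [hf, mul_zero]
  intro h1
  apply hx
  have h2 := (U p (-(N + L : ℕ) : ℤ)).add_mem (U_anti (by push_cast; omega) h1)
    (U_anti (by push_cast; omega) (hL α hα))
  rw [sub_add_cancel, dil_mem_U] at h2
  exact U_anti (by omega) h2

end

noncomputable section

variable {p : ℕ} [NeZero p]

/-! ### The energy of a function at a given scale -/

omit [NeZero p] in
theorem sub_mem_U_of_dil_sub_mem {j N : ℤ} {x κ : Vilenkin p} (hx : dil j x - κ ∈ U p N) :
    x - dil (-j) κ ∈ U p (N + j) := by
  have h1 : dil j (x - dil (-j) κ) ∈ U p N := by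
    rw [dil_sub, dil_dil]; simpa using hx
  exact dil_mem_U.1 h1

/-- The square of the factor `p^(j/2)`. -/
theorem rpow_half_sq (j : ℤ) : ((p : ℝ) ^ ((j : ℝ) / 2)) ^ 2 = (p : ℝ) ^ j := by
  have hp0 : (0 : ℝ) < p := by exact_mod_cast NeZero.pos p
  rw [← Real.rpow_natCast, ← Real.rpow_mul hp0.le, ← Real.rpow_intCast]
  congr 1
  push_cast
  ring

theorem integral_dilTranslate (f : Vilenkin p → ℂ) (j : ℤ) (κ : Vilenkin p) :
    ∫ x, dilTranslate f j κ x ∂haar p =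
      (((p : ℝ) ^ ((j : ℝ) / 2) * (p : ℝ) ^ (-j) : ℝ) : ℂ) * ∫ x, f x ∂haar p := by
  simp only [dilTranslate]
  rw [integral_const_mul, integral_dil_sub, Complex.real_smul]
  push_cast
  ring

/-- The dilated translate lives on a coset of `U_{N+j}`, and `f` is constant there. -/
theorem ip_dilTranslate_of_const {f φ : Vilenkin p → ℂ} {l N : ℤ}
    (hf : ∀ x u, u ∈ U p l → f (x + u) = f x) (hφ : ∀ x ∉ U p N, φ x = 0) {j : ℤ}
    (hj : l ≤ N + j) (κ : Vilenkin p) :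
    ip f (dilTranslate φ j κ) = f (dil (-j) κ) *
      ((((p : ℝ) ^ ((j : ℝ) / 2) * (p : ℝ) ^ (-j) : ℝ) : ℂ) * conj (∫ x, φ x ∂haar p)) := by
  have h1 : ∀ x, f x * conj (dilTranslate φ j κ x) =
      f (dil (-j) κ) * conj (dilTranslate φ j κ x) := fun x => by
    by_cases hx : dil j x - κ ∈ U p N
    · have := hf (dil (-j) κ) (x - dil (-j) κ) (U_anti hj (sub_mem_U_of_dil_sub_mem hx))
      rw [add_sub_cancel] at this
      rw [this]
    · simp [dilTranslate, hφ _ hx]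
  simp only [ip, h1]
  rw [integral_const_mul, integral_conj, integral_dilTranslate, map_mul, Complex.conj_ofReal]

/-- The cosets `A^(-j) κ ⊕ U_j`, each of measure `p^(-j)`, partition the group. -/
theorem hasSum_integral_const {f : Vilenkin p → ℝ} {j : ℤ}
    (hf : ∀ x u, u ∈ U p j → f (x + u) = f x) (hi : Integrable f (haar p)) :
    HasSum (fun κ : H p => (p : ℝ) ^ (-j) * f (dil (-j) κ)) (∫ x, f x ∂haar p) := by
  let s : H p → Set (Vilenkin p) := fun κ => {x | x - dil (-j) (κ : Vilenkin p) ∈ U p j}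
  have hs : ∀ (κ : H p) x, x ∈ s κ ↔ intPart (dil j x) = κ := fun κ x => by
    rw [intPart_eq_iff]
    change x - dil (-j) (κ : Vilenkin p) ∈ U p j ↔ _
    have h2 : dil j x - κ = dil j (x - dil (-j) (κ : Vilenkin p)) := by
      rw [dil_sub, dil_dil]; simp
    rw [h2, dil_mem_U, zero_add]
  have hU : ⋃ κ, s κ = Set.univ :=
    Set.eq_univ_of_forall fun x => Set.mem_iUnion.2 ⟨_, (hs _ x).2 rfl⟩
  have h1 := hasSum_integral_iUnion (μ := haar p) (s := s) (f := f)
    (fun κ => (isOpen_coset _ _).measurableSet)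
    (fun κ κ' hne => Set.disjoint_left.2 fun x h1 h2 =>
      hne (((hs κ x).1 h1).symm.trans ((hs κ' x).1 h2))) hi.integrableOn
  rw [hU, setIntegral_univ] at h1
  have h3 : ∀ κ : H p, ∫ x in s κ, f x ∂haar p = (p : ℝ) ^ (-j) * f (dil (-j) κ) := fun κ => by
    rw [setIntegral_congr_fun (g := fun _ => f (dil (-j) κ)) (isOpen_coset _ _).measurableSet]
    · rw [setIntegral_const, smul_eq_mul, Measure.real, haar_coset, haar_U, toReal_pow]
    · intro x hx
      have := hf (dil (-j) (κ : Vilenkin p)) _ hx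
      rwa [add_sub_cancel] at this
  simpa only [h3] using h1

/-- At fine scales the energy is a Riemann sum of `|f|²` that is already exact, so the limit `j → ∞`
is attained. -/
theorem hasSum_ip_dilTranslate_of_const {f φ : Vilenkin p → ℂ} {l : ℤ} {N : ℕ}
    (hf : ∀ x u, u ∈ U p l → f (x + u) = f x) (hf2 : MemLp f 2 (haar p))
    (hφ : ∀ x ∉ U p (-N), φ x = 0) {j : ℤ} (hj : l + N ≤ j) :
    HasSum (fun κ : H p => ‖ip f (dilTranslate φ j κ)‖ ^ 2)
      (‖∫ x, φ x ∂haar p‖ ^ 2 * ∫ x, ‖f x‖ ^ 2 ∂haar p) := by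
  have hp0 : (p : ℝ) ≠ 0 := by exact_mod_cast NeZero.ne p
  have h1 := (hasSum_integral_const (f := fun x => ‖f x‖ ^ 2) (j := j)
    (fun x u hu => by rw [hf x u (U_anti (by omega) hu)])
    ((memLp_two_iff_integrable_sq_norm hf2.1).1 hf2)).mul_left (‖∫ x, φ x ∂haar p‖ ^ 2)
  have h2 : ∀ κ : H p, ‖ip f (dilTranslate φ j κ)‖ ^ 2 =
      ‖∫ x, φ x ∂haar p‖ ^ 2 * ((p : ℝ) ^ (-j) * ‖f (dil (-j) κ)‖ ^ 2) := fun κ => ?_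
  · rw [funext h2]
    exact h1
  rw [ip_dilTranslate_of_const hf hφ (by omega), norm_mul, norm_mul, RCLike.norm_conj,
    Complex.norm_real, Real.norm_eq_abs, mul_pow, mul_pow, sq_abs, mul_pow, rpow_half_sq]
  have : (p : ℝ) ^ j * ((p : ℝ) ^ (-j)) ^ 2 = (p : ℝ) ^ (-j) := by
    rw [pow_two, ← mul_assoc, ← zpow_add₀ hp0, add_neg_cancel, zpow_zero, one_mul]
  rw [this]
  ring

omit [NeZero p] in
theorem mem_U_of_dilTranslate_ne_zero {φ : Vilenkin p → ℂ} {N L : ℤ}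
    (hφ : ∀ x ∉ U p N, φ x = 0) {j : ℤ} {κ x : Vilenkin p} (hx : x ∈ U p L)
    (h0 : dilTranslate φ j κ x ≠ 0) : κ ∈ U p (min N (L - j)) := by
  have h1 : dil j x - κ ∈ U p N := by
    by_contra hn
    exact h0 (by simp [dilTranslate, hφ _ hn])
  have h2 : dil j x ∈ U p (L - j) := dil_mem_U.2 (by simpa using hx)
  have h3 := (U p (min N (L - j))).sub_mem (U_anti (min_le_right _ _) h2)
    (U_anti (min_le_left _ _) h1)
  simpa using h3

theorem ip_dilTranslate_eq_zero {f φ : Vilenkin p → ℂ} {N L : ℤ} (hf : ∀ x ∉ U p L, f x = 0)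
    (hφ : ∀ x ∉ U p N, φ x = 0) {j : ℤ} {κ : Vilenkin p} (hκ : κ ∉ U p (min N (L - j))) :
    ip f (dilTranslate φ j κ) = 0 := by
  refine integral_eq_zero_of_ae (Eventually.of_forall fun x => ?_)
  by_cases hx : x ∈ U p L
  · have : dilTranslate φ j κ x = 0 := by
      by_contra h0
      exact hκ (mem_U_of_dilTranslate_ne_zero hφ hx h0)
    simp [this]
  · simp [hf x hx]

/-- Only `x` in `U_L` matters, which after dilation is the part of `φ` on one coset of `U_{L-j}`;
then Cauchy–Schwarz. The coset shrinks as `j → -∞`. -/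
theorem norm_ip_dilTranslate_sq_le {f φ : Vilenkin p → ℂ} {L : ℤ} (hf : ∀ x ∉ U p L, f x = 0)
    (hf2 : MemLp f 2 (haar p)) (hφ : MemLp φ 2 (haar p)) (j : ℤ) (κ : Vilenkin p) :
    ‖ip f (dilTranslate φ j κ)‖ ^ 2 ≤ (∫ x, ‖f x‖ ^ 2 ∂haar p) *
      ∫ x in {x | x - -κ ∈ U p (L - j)}, ‖φ x‖ ^ 2 ∂haar p := by
  have hp0 : (p : ℝ) ≠ 0 := by exact_mod_cast NeZero.ne p
  let φ' : Vilenkin p → ℂ := {x | x - -κ ∈ U p (L - j)}.indicator φ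
  have hm : MeasurableSet {x : Vilenkin p | x - -κ ∈ U p (L - j)} := (isOpen_coset _ _).measurableSet
  have hφ' : MemLp φ' 2 (haar p) := hφ.indicator hm
  have h1 : ip f (dilTranslate φ j κ) = ip f (dilTranslate φ' j κ) := by
    refine integral_congr_ae (Eventually.of_forall fun x => ?_)
    simp only
    by_cases hx : x ∈ U p L
    · congr 2
      simp only [dilTranslate]
      congr 1
      refine (Set.indicator_of_mem (f := φ) ?_).symm
      change dil j x - κ - -κ ∈ U p (L - j)
      rw [sub_neg_eq_add, sub_add_cancel, dil_mem_U]
      simpa using hx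
    · simp [hf x hx]
  rw [h1]
  refine (norm_ip_sq_le hf2 (hφ'.dilTranslate j κ)).trans (le_of_eq ?_)
  congr 1
  have h2 : ∀ x, ‖dilTranslate φ' j κ x‖ ^ 2 = (p : ℝ) ^ j * ‖φ' (dil j x - κ)‖ ^ 2 := fun x => by
    rw [dilTranslate, norm_mul, mul_pow, Complex.norm_real, Real.norm_eq_abs, sq_abs, rpow_half_sq]
  simp only [h2]
  rw [integral_const_mul, integral_dil_sub (fun x => ‖φ' x‖ ^ 2), smul_eq_mul, ← mul_assoc,
    ← zpow_add₀ hp0, add_neg_cancel, zpow_zero, one_mul, ← integral_indicator hm]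
  congr 1 with x
  by_cases hx : x ∈ {x : Vilenkin p | x - -κ ∈ U p (L - j)}
  · simp only [φ', Set.indicator_of_mem hx]
  · simp only [φ', Set.indicator_of_notMem hx]; simp

theorem tendsto_haar_U (hp : 2 ≤ p) (L : ℤ) :
    Tendsto (fun n : ℕ => haar p (U p (L + n))) atTop (𝓝 0) := by
  have h0 : (p : ℝ≥0∞) ≠ 0 := by exact_mod_cast NeZero.ne p
  have ht : (p : ℝ≥0∞) ≠ ⊤ := ENNReal.natCast_ne_top p
  have h1 : ∀ n : ℕ, haar p (U p (L + n)) = (p : ℝ≥0∞) ^ (-L) * ((p : ℝ≥0∞)⁻¹) ^ n := fun n => by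
    rw [haar_U, neg_add, ENNReal.zpow_add h0 ht, ENNReal.zpow_neg _ (n : ℤ), zpow_natCast,
      ENNReal.inv_pow]
  simp only [h1]
  have h2 : Tendsto (fun n : ℕ => ((p : ℝ≥0∞)⁻¹) ^ n) atTop (𝓝 0) :=
    ENNReal.tendsto_pow_atTop_nhds_zero_of_lt_one
      (ENNReal.inv_lt_one.2 (by exact_mod_cast hp))
  have h3 := ENNReal.Tendsto.const_mul h2 (Or.inr (pow_ne_top (p := p) (-L)))
  simpa using h3

/-- At all scales `-n ≤ 0` the nonzero terms lie in one finite set of `κ`, and each term is bounded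
by the integral of `|φ|²` over a set whose measure tends to zero. -/
theorem tendsto_tsum_ip_dilTranslate (hp : 2 ≤ p) {f φ : Vilenkin p → ℂ} {N L : ℤ}
    (hf : ∀ x ∉ U p L, f x = 0) (hf2 : MemLp f 2 (haar p)) (hφ : ∀ x ∉ U p N, φ x = 0)
    (hφ2 : MemLp φ 2 (haar p)) :
    Tendsto (fun n : ℕ => ∑' κ : H p, ‖ip f (dilTranslate φ (-n) κ)‖ ^ 2) atTop (𝓝 0) := by
  let T := (finite_H_inter_U (p := p) (min N L)).toFinset
  have h1 : ∀ n : ℕ, ∑' κ : H p, ‖ip f (dilTranslate φ (-n) κ)‖ ^ 2 =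
      ∑ κ ∈ T, ‖ip f (dilTranslate φ (-n) κ)‖ ^ 2 := fun n => by
    refine tsum_eq_sum fun κ hκ => ?_
    rw [ip_dilTranslate_eq_zero hf hφ]
    · simp
    · intro h2
      exact hκ (by simpa [T] using U_anti (by omega) h2)
  simp only [h1]
  rw [← Finset.sum_const_zero (s := T)]
  refine tendsto_finsetSum _ fun κ _ => ?_
  have hi : Integrable (fun x => ‖φ x‖ ^ 2) (haar p) := (memLp_two_iff_integrable_sq_norm hφ2.1).1 hφ2
  have h2 := hi.tendsto_setIntegral_nhds_zero (l := atTop)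
    (s := fun n : ℕ => {x | x - -(κ : Vilenkin p) ∈ U p (L + n)}) (by
      simpa only [Function.comp_def, haar_coset] using tendsto_haar_U hp L)
  have h3 := h2.const_mul (∫ x, ‖f x‖ ^ 2 ∂haar p)
  rw [mul_zero] at h3
  refine squeeze_zero (fun _ => by positivity) (fun n => ?_) h3
  have := norm_ip_dilTranslate_sq_le hf hf2 hφ2 (-n) κ
  simpa using this

end

noncomputable section

variable {p : ℕ} [NeZero p]

/-! ### Parseval identities on dense sets -/

/-- The bound for finite partial sums is a closed condition and extends from `D`; it makes the
analysis map to `ℓ²` continuous, so the equality of squared norms extends as well. -/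
theorem hasSum_norm_inner_sq_of_dense {E ι : Type*} [NormedAddCommGroup E] [InnerProductSpace ℂ E]
    {g : ι → E} {C : ℝ} {D : Set E} (hD : Dense D)
    (h : ∀ f ∈ D, HasSum (fun i => ‖inner ℂ (g i) f‖ ^ 2) (C * ‖f‖ ^ 2)) (f : E) :
    HasSum (fun i => ‖inner ℂ (g i) f‖ ^ 2) (C * ‖f‖ ^ 2) := by
  have hle : ∀ (s : Finset ι) (f : E), ∑ i ∈ s, ‖inner ℂ (g i) f‖ ^ 2 ≤ C * ‖f‖ ^ 2 := by
    intro s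
    have hcl : IsClosed {f : E | ∑ i ∈ s, ‖inner ℂ (g i) f‖ ^ 2 ≤ C * ‖f‖ ^ 2} :=
      isClosed_le (by fun_prop) (by fun_prop)
    intro f
    exact hcl.closure_subset_iff.2
      (fun f hf => sum_le_hasSum s (fun _ _ => by positivity) (h f hf)) (hD f)
  have hsum : ∀ f : E, Summable fun i => ‖inner ℂ (g i) f‖ ^ 2 := fun f =>
    summable_of_sum_le (fun _ => by positivity) fun s => hle s f
  let T : E →ₗ[ℂ] lp (fun _ : ι => ℂ) 2 :=
    { toFun := fun f => ⟨fun i => inner ℂ (g i) f, memℓp_gen (by simpa using hsum f)⟩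
      map_add' := fun x y => Subtype.ext (funext fun i => inner_add_right _ _ _)
      map_smul' := fun c x => Subtype.ext (funext fun i => inner_smul_right _ _ _) }
  have hT : ∀ f, ‖T f‖ ^ 2 = ∑' i, ‖inner ℂ (g i) f‖ ^ 2 := fun f => by
    have := lp.norm_rpow_eq_tsum (p := 2) (by simp) (T f)
    simp only [ENNReal.toReal_ofNat, Real.rpow_ofNat] at this
    exact this
  have hcont : Continuous T := by
    refine (T.mkContinuous √|C| fun f => ?_).continuous
    rw [← abs_of_nonneg (norm_nonneg (T f)), ← abs_of_nonneg (norm_nonneg f),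
      ← abs_of_nonneg (Real.sqrt_nonneg |C|), ← abs_mul, abs_norm]
    refine abs_le_of_sq_le_sq' ?_ (abs_nonneg _) |>.2
    rw [sq_abs, mul_pow, Real.sq_sqrt (abs_nonneg _), hT]
    refine ((hsum f).tsum_le_of_sum_le fun s => hle s f).trans ?_
    gcongr
    exact le_abs_self C
  have key : (fun f => ‖T f‖ ^ 2) = fun f => C * ‖f‖ ^ 2 :=
    Continuous.ext_on hD (by fun_prop) (by fun_prop) fun f hf => by
      simp only [hT]
      exact (h f hf).tsum_eq
  rw [← congrFun key f]
  simp only [hT]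
  exact (hsum f).hasSum

theorem hasSum_prod_of_nonneg {α β : Type*} {f : α × β → ℝ} {g : α → ℝ} {s : ℝ}
    (hf : ∀ x, 0 ≤ f x) (hg : ∀ a, HasSum (fun b => f (a, b)) (g a)) (hs : HasSum g s) :
    HasSum f s := by
  have h1 : Summable f := (summable_prod_of_nonneg hf).2
    ⟨fun a => (hg a).summable, by simpa only [(hg _).tsum_eq] using hs.summable⟩
  have h2 := h1.hasSum.prod_fiberwise hg
  rw [← h2.unique hs]
  exact h1.hasSum

/-- Sum of a telescoping family of nonnegative differences indexed by the integers. -/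
theorem hasSum_int_telescope {S : ℤ → ℝ} {c : ℝ} (hmono : ∀ j, S j ≤ S (j + 1))
    (htop : Tendsto (fun n : ℕ => S n) atTop (𝓝 c))
    (hbot : Tendsto (fun n : ℕ => S (-n)) atTop (𝓝 0)) :
    HasSum (fun j => S (j + 1) - S j) c := by
  have h1 : HasSum (fun n : ℕ => S ((n : ℤ) + 1) - S n) (c - S 0) := by
    rw [hasSum_iff_tendsto_nat_of_nonneg fun n => sub_nonneg.2 (hmono _)]
    have : ∀ n : ℕ, ∑ i ∈ Finset.range n, (S ((i : ℤ) + 1) - S i) = S n - S 0 := fun n => by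
      have := Finset.sum_range_sub (fun i : ℕ => S i) n
      simpa using this
    simp only [this]
    exact htop.sub_const _
  have h2 : HasSum (fun n : ℕ => S (-((n : ℤ) + 1) + 1) - S (-((n : ℤ) + 1))) (S 0) := by
    rw [hasSum_iff_tendsto_nat_of_nonneg fun n => sub_nonneg.2 (hmono _)]
    have : ∀ n : ℕ, ∑ i ∈ Finset.range n, (S (-((i : ℤ) + 1) + 1) - S (-((i : ℤ) + 1))) =
        S 0 - S (-n) := fun n => by
      have := Finset.sum_range_sub' (fun i : ℕ => S (-i)) n
      simp only [Nat.cast_add, Nat.cast_one, Nat.cast_zero, neg_zero] at this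
      rw [← this]
      refine Finset.sum_congr rfl fun i _ => ?_
      congr 2
      ring
    simp only [this]
    simpa using hbot.const_sub (S 0)
  have h3 := HasSum.of_nat_of_neg_add_one (f := fun j => S (j + 1) - S j) h1 h2
  rwa [sub_add_cancel] at h3

/-! ### Density of locally constant functions -/

/-- Functions constant on the cosets of some `U_l` and vanishing outside some `U_L`. -/
def IsStep (f : Vilenkin p → ℂ) : Prop :=
  ∃ l L : ℤ, (∀ x u, u ∈ U p l → f (x + u) = f x) ∧ ∀ x ∉ U p L, f x = 0

theorem IsStep.memLp {f : Vilenkin p → ℂ} (hf : IsStep f) (q : ℝ≥0∞) : MemLp f q (haar p) := by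
  obtain ⟨l, L, h1, h2⟩ := hf
  refine Continuous.memLp_of_hasCompactSupport (continuous_iff_continuousAt.2 fun x => ?_)
    (hasCompactSupport_of_subset h2)
  refine (continuousAt_const (y := f x)).congr ?_
  filter_upwards [(nhds_hasBasis x).mem_of_mem (i := l) trivial] with y hy
  have := h1 x _ hy
  rwa [add_sub_cancel, eq_comm] at this

omit [NeZero p] in
theorem exists_uniform_const {g : Vilenkin p → ℂ} (hg : Continuous g) (hs : HasCompactSupport g)
    {δ : ℝ} (hδ : 0 < δ) : ∃ l : ℤ, ∀ x y, x - y ∈ U p l → dist (g x) (g y) < δ := by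
  let _ : UniformSpace (Vilenkin p) := IsTopologicalAddGroup.rightUniformSpace _
  have _ : IsUniformAddGroup (Vilenkin p) := isUniformAddGroup_of_addCommGroup
  have h1 := hs.uniformContinuous_of_continuous hg
  have h2 := h1 (Metric.dist_mem_uniformity hδ)
  rw [uniformity_eq_comap_nhds_zero] at h2
  obtain ⟨t, ht, h3⟩ := h2
  obtain ⟨l, -, hl⟩ := (nhds_hasBasis (0 : Vilenkin p)).mem_iff.1 ht
  refine ⟨l, fun x y hxy => ?_⟩
  have := @h3 (y, x) (hl (by simpa using hxy))
  rw [dist_comm]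
  exact this

/-- Approximate by a continuous compactly supported function, then sample it at one point of each
coset of a small `U_l`, using uniform continuity. -/
theorem exists_isStep_eLpNorm_sub_lt {f : Vilenkin p → ℂ} (hf : MemLp f 2 (haar p)) {ε : ℝ≥0∞}
    (hε : ε ≠ 0) : ∃ g, IsStep g ∧ eLpNorm (f - g) 2 (haar p) < ε := by
  have hε2 : ε / 2 ≠ 0 := by simpa using hε
  obtain ⟨g, hgs, hfg, hgc, hg2⟩ := hf.exists_hasCompactSupport_eLpNorm_sub_le
    (by simp) hε2
  obtain ⟨N, hN⟩ := exists_support_subset hgs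
  have hfin : haar p (U p (-N)) ^ (1 / (2 : ℝ≥0∞).toReal) ≠ ⊤ :=
    ENNReal.rpow_ne_top_of_nonneg (by positivity) (isCompact_U _).measure_lt_top.ne
  obtain ⟨δ, hδ, hlt⟩ := ENNReal.exists_nnreal_pos_mul_lt hfin hε2
  obtain ⟨l', hl'⟩ := exists_uniform_const hgc hgs (δ := δ) hδ
  -- With `l ≥ -N` each coset of `U_l` lies inside or outside `U_{-N}`, so sampling does not enlarge
  -- the support.
  let l := max l' (-N)
  let g' : Vilenkin p → ℂ := fun x => g (dil (-l) (intPart (dil l x) : Vilenkin p))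
  have hrep := fun x : Vilenkin p => sub_dil_intPart_mem l x
  have hstep : ∀ x u, u ∈ U p l → g' (x + u) = g' x := fun x u hu => by
    have : intPart (dil l (x + u)) = intPart (dil l x) := by
      rw [intPart_eq_iff, dil_add, add_sub_right_comm]
      exact (U p 0).add_mem (sub_intPart_mem _) (dil_mem_U.2 (by simpa using hu))
    simp only [g', this]
  have hzero : ∀ x ∉ U p (-N), g' x = 0 := fun x hx => by
    refine hN _ fun h1 => hx ?_
    have := (U p (-N)).add_mem (U_anti (le_max_right l' (-N)) (hrep x)) h1
    rwa [sub_add_cancel] at this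
  have hbound : ∀ x, ‖(g - g') x‖ ≤
      (U p (-N) : Set (Vilenkin p)).indicator (fun _ => (δ : ℝ)) x := fun x => by
    by_cases hx : x ∈ U p (-N)
    · rw [Set.indicator_of_mem (show x ∈ (U p (-N) : Set (Vilenkin p)) from hx), Pi.sub_apply,
        ← dist_eq_norm]
      exact (hl' _ _ (U_anti (le_max_left _ _) (hrep x))).le
    · rw [Set.indicator_of_notMem (show x ∉ (U p (-N) : Set (Vilenkin p)) from hx), Pi.sub_apply,
        hN x hx, hzero x hx]
      simp
  have h3 : eLpNorm (g - g') 2 (haar p) < ε / 2 := by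
    refine ((eLpNorm_mono_real hbound).trans (eLpNorm_indicator_const_le _ _)).trans_lt ?_
    simpa using hlt
  have hst : IsStep g' := ⟨l, -N, hstep, hzero⟩
  refine ⟨g', hst, ?_⟩
  have h4 : f - g' = (f - g) + (g - g') := by abel
  rw [h4]
  refine (eLpNorm_add_le (hf.1.sub hg2.1) (hg2.1.sub (hst.memLp 2).1) (by norm_num)).trans_lt ?_
  rcases eq_or_ne ε ⊤ with rfl | hne
  · have h5 : eLpNorm (f - g) 2 (haar p) < ⊤ := (hf.sub hg2).2
    have h6 : eLpNorm (g - g') 2 (haar p) < ⊤ := (hg2.sub (hst.memLp 2)).2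
    exact ENNReal.add_lt_top.2 ⟨h5, h6⟩
  · calc _ < ε / 2 + ε / 2 := ENNReal.add_lt_add_of_le_of_lt
          (ne_top_of_le_ne_top (ENNReal.div_ne_top hne (by simp)) hfg) hfg h3
      _ = ε := ENNReal.add_halves ε

theorem dense_isStep :
    Dense {F : Lp ℂ 2 (haar p) | ∃ (f : Vilenkin p → ℂ) (hf : IsStep f),
      F = (hf.memLp 2).toLp f} := by
  intro F
  rw [EMetric.mem_closure_iff]
  intro ε hε
  obtain ⟨g, hg, hlt⟩ := exists_isStep_eLpNorm_sub_lt (Lp.memLp F) hε.ne'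
  refine ⟨_, ⟨g, hg, rfl⟩, ?_⟩
  conv_lhs => rw [← Lp.toLp_coeFn F (Lp.memLp F)]
  rw [Lp.edist_toLp_toLp]
  exact hlt

/-! ### Refinable functions have nonzero mean -/

/-- If the mean were zero, every step function would be orthogonal to all fine-scale translates of
`φ`; the refinement equation carries this down to scale 0, so `φ` would be orthogonal to a dense
set. -/
theorem integral_ne_zero_of_refinable {φ : Vilenkin p → ℂ} (hφ : MemLp φ 2 (haar p)) {N : ℕ}
    (hN : ∀ x ∉ U p (-N), φ x = 0) {a : H p →₀ ℂ} (ha : φ =ᵐ[haar p] synth a φ)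
    (hne : ¬ φ =ᵐ[haar p] 0) : ∫ x, φ x ∂haar p ≠ 0 := by
  intro h0
  apply hne
  have hz : ∀ f, IsStep f → ip f φ = 0 := by
    rintro f hf
    have hf2 := hf.memLp 2
    obtain ⟨l, L, h1, h2⟩ := hf
    -- A scale at which `f` is constant on the support of each translate; `J` applications of the
    -- refinement equation lead from it to `φ` itself.
    let J := (l + N).toNat
    have key : ∀ n : ℕ, ∀ κ : H p, ip f (dilTranslate φ ((J : ℤ) - n) κ) = 0 := by
      intro n
      induction n with
      | zero =>
        intro κ
        rw [ip_dilTranslate_of_const h1 hN (by omega), h0]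
        simp
      | succ n ih =>
        intro κ
        rw [ip_congr_right (dilTranslate_congr_ae ha _ _), ip_dilTranslate_synth hf2 hφ]
        have e : (J : ℤ) - (n + 1 : ℕ) + 1 = J - n := by push_cast; ring
        simp only [analysisFilter, e, ih]
        simp
    have := key J 0
    rwa [sub_self, ZeroMemClass.coe_zero, dilTranslate_zero] at this
  have h3 : hφ.toLp φ = 0 := dense_isStep.eq_zero_of_inner_left ℂ (by
    rintro _ ⟨f, hf, rfl⟩
    rw [inner_toLp (hf.memLp 2) hφ]
    exact hz f hf)
  have h4 := hφ.coeFn_toLp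
  rw [h3] at h4
  exact h4.symm.trans (Lp.coeFn_zero _ _ _)

end

noncomputable section

variable {p : ℕ} [NeZero p]

/-! ### Masks -/

/-- Since `A U_{-N} = U_{-(N+1)}` is a subgroup containing `U_{-N}`, truncating at `p^(N+1)` loses
nothing on `U_{-N}` and leaves only zero terms outside it. -/
theorem exists_isMask {φ : Vilenkin p → ℂ} (hp : 2 ≤ p) (hφ : IsRefinable φ) {N : ℕ}
    (hN : ∀ x ∉ U p (-N), φ x = 0) : ∃ m₀, IsMask φ m₀ := by
  obtain ⟨-, a, ha⟩ := hφ
  refine ⟨_, N + 1, a, ?_, fun ω => rfl⟩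
  filter_upwards [ha] with x hx
  by_cases hxN : x ∈ U p (-N)
  · rw [Finset.mul_sum]
    refine hx.unique (hasSum_sum_of_ne_finset_zero fun α hα => ?_)
    rw [hN, mul_zero, mul_zero]
    intro h1
    refine hα (Finset.mem_range.2 (lt_pow_of_h_mem_U hp ?_))
    have h2 := (U p (-(N + 1 : ℕ) : ℤ)).sub_mem ((dil_mem_U (n := 1)).2 (U_anti (by push_cast; omega) hxN))
      (U_anti (by push_cast; omega) h1)
    rwa [sub_sub_cancel] at h2
  · rw [hN x hxN, Finset.sum_eq_zero, mul_zero]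
    intro α hα
    rw [hN, mul_zero]
    intro h1
    apply hxN
    have h2 := (U p (-(N + 1 : ℕ) : ℤ)).add_mem (U_anti (by push_cast; omega) h1)
      (h_mem_U (Finset.mem_range.1 hα))
    rw [sub_add_cancel, dil_mem_U] at h2
    exact U_anti (by push_cast; omega) h2

theorem IsMask.exists_trigPoly {φ m₀ : Vilenkin p → ℂ} (hm : IsMask φ m₀) :
    ∃ a : H p →₀ ℂ, φ =ᵐ[haar p] synth a φ ∧ m₀ = trigPoly a := by
  obtain ⟨n, a, h1, h2⟩ := hm
  let d : H p →₀ ℂ := ∑ α ∈ Finset.range (p ^ n), Finsupp.single ⟨h p α, h_mem_H α⟩ (a α)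
  have hd : ∀ F : H p → ℂ, (d.sum fun α z => z * F α) =
      ∑ α ∈ Finset.range (p ^ n), a α * F ⟨h p α, h_mem_H α⟩ := fun F => by
    rw [← Finsupp.sum_finsetSum_index (by simp) (by intros; ring)]
    simp
  refine ⟨d, ?_, ?_⟩
  · filter_upwards [h1] with x hx
    rw [hx, synth, hd fun α => φ (dil 1 x - α)]
  · ext ω
    rw [h2, trigPoly, hd fun α => conj (chi ω (α : Vilenkin p))]
    rfl

/-! ### The unitary extension principle -/

/-- Energy conservation in the filter bank makes the wavelet energies a telescoping sum over scales,
with frame constant `|∫φ|²` coming from the fine-scale end. -/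
theorem isTightFrame_synth {φ : Vilenkin p → ℂ} (hp : 2 ≤ p) (hφ : MemLp φ 2 (haar p)) {N : ℕ}
    (hN : ∀ x ∉ U p (-N), φ x = 0) {r : ℕ} (a : Fin (r + 1) → H p →₀ ℂ)
    (ha0 : φ =ᵐ[haar p] synth (a 0) φ)
    (ha : ∀ ω, ∀ l l' : Fin p, ∑ ν, trigPoly (a ν) (ω + delta p l) *
      conj (trigPoly (a ν) (ω + delta p l')) = if l = l' then 1 else 0)
    (h0 : ∫ x, φ x ∂haar p ≠ 0) :
    IsTightFrame fun i : Fin r × ℤ × ℕ => wavelet (synth (a i.1.succ) φ) i.2.1 i.2.2 := by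
  have hψ2 : ∀ i : Fin r × ℤ × ℕ, MemLp (wavelet (synth (a i.1.succ) φ) i.2.1 i.2.2) 2 (haar p) :=
    fun i => (hφ.synth _).dilTranslate _ _
  refine ⟨hψ2, ‖∫ x, φ x ∂haar p‖ ^ 2, by positivity, ?_⟩
  have step : ∀ f, IsStep f → HasSum
      (fun i : Fin r × ℤ × ℕ => ‖ip f (wavelet (synth (a i.1.succ) φ) i.2.1 i.2.2)‖ ^ 2)
      (‖∫ x, φ x ∂haar p‖ ^ 2 * ∫ x, ‖f x‖ ^ 2 ∂haar p) := by
    rintro f hf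
    have hf2 := hf.memLp 2
    obtain ⟨l, L, hl, hL⟩ := hf
    let S : ℤ → ℝ := fun j => ∑' κ : H p, ‖ip f (dilTranslate φ j κ)‖ ^ 2
    have hfin : ∀ j : ℤ, (Function.support fun κ : H p => ip f (dilTranslate φ j κ)).Finite :=
      fun j => (finite_H_inter_U (p := p) (min (-N) (L - j))).subset fun κ hκ => by
        by_contra hn
        exact hκ (ip_dilTranslate_eq_zero hL hN hn)
    have hdiff : ∀ j, HasSum (fun q : Fin r × H p =>
        ‖ip f (dilTranslate (synth (a q.1.succ) φ) j q.2)‖ ^ 2) (S (j + 1) - S j) := by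
      intro j
      let c : H p →₀ ℂ := Finsupp.ofSupportFinite _ (hfin (j + 1))
      obtain ⟨t, ht, hct⟩ := exists_hasSum_analysisFilter a c ha
      have hc : (c : H p → ℂ) = fun κ : H p => ip f (dilTranslate φ (j + 1) κ) := rfl
      have h1 : ∀ ν (κ : H p), ip f (dilTranslate (synth (a ν) φ) j κ) =
          analysisFilter (a ν) c κ := fun ν κ => by
        rw [ip_dilTranslate_synth hf2 hφ, hc]
      have h2 : S (j + 1) = ∑ ν, t ν := hct.tsum_eq
      -- By the refinement equation, the low-pass channel of the filter bank returns the
      -- coefficients of `φ` one scale lower.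
      have h3 : S j = t 0 := by
        rw [← (ht 0).tsum_eq]
        refine tsum_congr fun κ => ?_
        rw [ip_congr_right (dilTranslate_congr_ae ha0 _ _), h1]
      rw [h2, h3, Fin.sum_univ_succ, add_sub_cancel_left]
      refine hasSum_prod_of_nonneg (fun _ => by positivity) (g := fun ν => t ν.succ)
        (fun ν => ?_) (hasSum_fintype _)
      simpa only [h1] using ht ν.succ
    have hmono : ∀ j, S j ≤ S (j + 1) := fun j =>
      sub_nonneg.1 ((hdiff j).nonneg fun _ => by positivity)
    have htop : Tendsto (fun n : ℕ => S n) atTop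
        (𝓝 (‖∫ x, φ x ∂haar p‖ ^ 2 * ∫ x, ‖f x‖ ^ 2 ∂haar p)) := by
      refine tendsto_const_nhds.congr' ?_
      filter_upwards [eventually_ge_atTop (l + N).toNat] with n hn
      exact (hasSum_ip_dilTranslate_of_const hl hf2 hN (by omega)).tsum_eq.symm
    have hall := hasSum_int_telescope hmono htop (tendsto_tsum_ip_dilTranslate hp hL hf2 hN hφ)
    have hprod := hasSum_prod_of_nonneg (f := fun q : ℤ × (Fin r × H p) =>
      ‖ip f (dilTranslate (synth (a q.2.1.succ) φ) q.1 q.2.2)‖ ^ 2)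
      (fun _ => by positivity) hdiff hall
    let e : Fin r × ℤ × ℕ ≃ ℤ × (Fin r × H p) :=
      { toFun := fun i => (i.2.1, i.1, hEquiv hp i.2.2)
        invFun := fun q => (q.2.1, q.1, (hEquiv hp).symm q.2.2)
        left_inv := fun i => by simp
        right_inv := fun q => by simp }
    exact (Equiv.hasSum_iff e).2 hprod
  intro f hf
  have key := hasSum_norm_inner_sq_of_dense (g := fun i => (hψ2 i).toLp _)
    (C := ‖∫ x, φ x ∂haar p‖ ^ 2) dense_isStep (by
      rintro _ ⟨g, hg, rfl⟩
      simp only [inner_toLp (hg.memLp 2), norm_toLp_sq]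
      exact step g hg) (hf.toLp f)
  simp only [inner_toLp hf, norm_toLp_sq] at key
  exact key

theorem generatesTightFrame {φ m₀ : Vilenkin p → ℂ} (hp : 2 ≤ p) (hφ : MemLp φ 2 (haar p))
    {N : ℕ} (hN : ∀ x ∉ U p (-N), φ x = 0) (hne : ¬ φ =ᵐ[haar p] 0) (hm : IsMask φ m₀)
    (hsum : ∀ ω, ∑ l ∈ Finset.range p, ‖m₀ (ω + delta p l)‖ ^ 2 ≤ 1) :
    GeneratesTightFrame φ m₀ := by
  obtain ⟨a₀, ha₀, rfl⟩ := hm.exists_trigPoly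
  obtain ⟨m, hmW, hM⟩ := exists_wavelet_masks (isWalshPolynomial_trigPoly a₀) hsum
  choose b hb using fun ν => (hmW ν).exists_trigPoly
  obtain rfl : m = fun ν => trigPoly (b ν) := funext hb
  let a : Fin (p + 1) → H p →₀ ℂ := Fin.cons a₀ b
  have hcons : (Fin.cons (trigPoly a₀) fun ν => trigPoly (b ν) : Fin (p + 1) → Vilenkin p → ℂ) =
      fun ν => trigPoly (a ν) := by
    ext ν
    refine Fin.cases ?_ (fun ν => ?_) ν <;> simp [a]
  -- On the finite measure space `U_{-N}`, `L²` is contained in `L¹`.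
  have hint : Integrable φ (haar p) := by
    have h1 : MemLp φ 1 ((haar p).restrict (U p (-N))) := by
      have : IsFiniteMeasure ((haar p).restrict (U p (-N) : Set (Vilenkin p))) :=
        ⟨by simpa using (isCompact_U _).measure_lt_top⟩
      exact (hφ.restrict _).mono_exponent (by norm_num)
    exact (integrableOn_iff_integrable_of_support_subset fun x hx => by
      by_contra hn
      exact hx (hN x hn)).1 (memLp_one_iff_integrable.1 h1)
  refine ⟨p, fun ν => trigPoly (b ν), fun ν => synth (b ν) φ, Nat.sub_le _ _, hmW, hM,
    fun ν => ⟨hφ.synth _, ?_, fun ω => fourier_synth hint _ _⟩, ?_⟩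
  · obtain ⟨L, hL⟩ := synth_eq_zero hN (b ν)
    exact hasCompactSupport_of_subset hL
  · refine isTightFrame_synth hp hφ hN a ha₀ (fun ω => ?_)
      (integral_ne_zero_of_refinable hφ hN ha₀ hne)
    have := hM ω
    rwa [hcons, maskMatrix_mul_conjTranspose_eq_one_iff] at this

theorem mask_zero_eq_one {φ : Vilenkin p → ℂ} (hφ : MemLp φ 2 (haar p))
    {N : ℕ} (hN : ∀ x ∉ U p (-N), φ x = 0) (hne : ¬ φ =ᵐ[haar p] 0) {a : H p →₀ ℂ}
    (ha : φ =ᵐ[haar p] synth a φ) : trigPoly a 0 = 1 := by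
  have h0 := integral_ne_zero_of_refinable hφ hN ha hne
  have hint : Integrable φ (haar p) := by
    -- The integral of a non-integrable function is 0 by convention, so a nonzero integral already
    -- implies integrability.
    by_contra hn
    exact h0 (integral_undef hn)
  have h1 := integral_synth hint a
  rw [← integral_congr_ae ha] at h1
  exact mul_right_cancel₀ h0 (h1.symm.trans (one_mul _).symm)

/-- Column 0 of the mask matrix consists of the values `m₀(ω ⊕ δ_l)`; only the orthonormality of its
rows enters. -/
theorem sum_norm_sq_le_one {φ m₀ : Vilenkin p → ℂ} (h : GeneratesTightFrame φ m₀)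
    (ω : Vilenkin p) : ∑ l ∈ Finset.range p, ‖m₀ (ω + delta p l)‖ ^ 2 ≤ 1 := by
  obtain ⟨r, m, -, -, -, hM, -⟩ := h
  have := sum_norm_sq_col_le_one _ (hM ω) 0
  rw [← Fin.sum_univ_eq_sum_range fun l => ‖m₀ (ω + delta p l)‖ ^ 2]
  simpa [maskMatrix] using this

end

end Vilenkin

theorem mainTheorem1 (p : ℕ) [NeZero p] (hp : 2 ≤ p) (φ : Vilenkin p → ℂ)
    (hφ : Vilenkin.IsRefinable φ) (hsupp : HasCompactSupport φ)
    (hne : ¬ φ =ᵐ[Vilenkin.haar p] 0) :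
    (∃ m₀ : Vilenkin p → ℂ, Vilenkin.IsMask φ m₀) ∧
    ∀ m₀ : Vilenkin p → ℂ, Vilenkin.IsMask φ m₀ →
      (Vilenkin.GeneratesTightFrame φ m₀ ↔
        Vilenkin.IsWalshPolynomial m₀ ∧ m₀ 0 = 1 ∧
          ∀ ω, ∑ l ∈ Finset.range p, ‖m₀ (ω + Vilenkin.delta p l)‖ ^ 2 ≤ 1) := by
  obtain ⟨N, hN⟩ := Vilenkin.exists_support_subset hsupp
  refine ⟨Vilenkin.exists_isMask hp hφ hN, fun m₀ hm => ⟨fun h => ?_, fun h =>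
    Vilenkin.generatesTightFrame hp hφ.1 hN hne hm h.2.2⟩⟩
  obtain ⟨a, ha, rfl⟩ := hm.exists_trigPoly
  exact ⟨Vilenkin.isWalshPolynomial_trigPoly a, Vilenkin.mask_zero_eq_one hφ.1 hN hne ha,
    Vilenkin.sum_norm_sq_le_one h⟩
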